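/- Let $k$ be a field (for instance algebraically closed of characteristic zero), let $n\ge 0$, let $q_{ij}\in k^\times$ $(1\le i,j\le n)$ satisfy $q_{ii}=1$ and $q_{ij}q_{ji}=1$ for $i\ne j$, and let $\gamma_1,\dots,\gamma_n\in k^\times$. The quantized Weyl algebra $A=A_n^{q,\gamma}(k)$ is the $k$-algebra generated by $x_1,y_1,\dots,x_n,y_n$ subject to the relations $$y_iy_j=q_{ij}y_jy_i\ (\text{all } i,j),\qquad x_ix_j=\gamma_iq_{ij}x_jx_i\ (i<j),$$ $$x_iy_j=q_{ji}y_jx_i\ (i<j),\qquad x_iy_j=\gamma_jq_{ji}y_jx_i\ (i>j),$$ $$x_jy_j=1+\gamma_jy_jx_j+\sum_{l<j}(\gamma_l-1)y_lx_l\ (\text{all } j).$$ Let $\mathcal F$ be the filtration of $A$ with $\deg x_i=\deg y_i=i$, that is, $\mathcal F_m$ is spanned by the products of generators of total degree at most $m$. Definition. Let $A$ be a $k$-algebra with an exhaustive $\mathbb N$-filtration $\mathcal F$, let $D$ be a finitely generated subring of $k$, and let $A_D$ be a $D$-subalgebra of $A$ with the induced filtration $A_D\cap\mathcal F_i$. An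 order of a $k$-algebra $R$ is a $D$-subalgebra $R_D$ that is free over $D$ and such that the natural map $R_D\otimes_D k\to R$ is an isomorphism. The filtered algebra $A$ is congenial by means of $D$ and $A_D$ if: 1. every $\mathcal F_i$ is a finite-dimensional $k$-vector space; 2. $A_D$ is an order of $A$, and every $A_D\cap\mathcal F_i$ is a finitely generated $D$-module; 3. the canonical map $\operatorname{gr}_{\mathcal F}A_D\to\operatorname{gr}_{\mathcal F}A$ makes $\operatorname{gr}_{\mathcal F}A_D$ an order of $\operatorname{gr}_{\mathcal F}A$; 4. every graded piece of $\operatorname{gr}_{\mathcal F}A_D$ is a finitely generated $D$-module, and $\operatorname{gr}_{\mathcal F}A_D\otimes_D C$ is (left and right) noetherian for every commutative noetherian $D$-algebra $C$; 5. for every factor ring $F$ of $D$ that is a finite field, $A_D\otimes_D F$ is a finitely generated, (left and right) noetherian $F$-algebra that satisfies a polynomial identity. It is congenial if such $D$ and $A_D$ exist. Theorem. The quantized Weyl algebra $A=A_n^{q,\gamma}(k)$ with the filtration $\mathcal F$ is congenial. More precisely, let $D$ be the subring of $k$ generated by all $q_{ij}$, $\gamma_i$ and $\gamma_i^{-1}$,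 and let $A_D$ be the $D$-subalgebra of $A$ generated by $x_1,y_1,\dots,x_n,y_n$. Then $A$ is congenial by means of $D$ and $A_D$; in particular the reductions $A_D\otimes_D F$ to finite fields are PI. Moreover, the associated graded rings are quantum affine spaces: there are units $p_{cd}\in D^\times$, indexed by pairs $c,d$ of the $2n$ generators, with $p_{cc}=1$ and $p_{cd}p_{dc}=1$, such that $\operatorname{gr}_{\mathcal F}A_D$ (respectively $\operatorname{gr}_{\mathcal F}A$) is isomorphic to the $D$-algebra (respectively $k$-algebra) generated by $2n$ elements $z_c$ subject to $z_cz_d=p_{cd}z_dz_c$, with $z_c$ corresponding to the class, in degree $i$, of the generator $c\in\{x_i,y_i\}$. -/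

import Mathlib

open scoped TensorProduct DirectSum

noncomputable section

/-! ### Filtered algebras and associated graded algebras -/

/-- An exhaustive `ℕ`-filtration of an `R`-algebra `A` by `R`-submodules
`A₀ ⊆ A₁ ⊆ A₂ ⊆ ⋯` with `1 ∈ A₀` and `Aᵢ Aⱼ ⊆ Aᵢ₊ⱼ`. -/
structure AlgFiltration (R A : Type*) [CommRing R] [Ring A] [Algebra R A] where
  obj : ℕ → Submodule R A
  mono : Monotone obj
  one_mem : (1 : A) ∈ obj 0
  mul_mem : ∀ {i j : ℕ} {a b : A}, a ∈ obj i → b ∈ obj j → a * b ∈ obj (i + j)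
  exhaustive : ∀ a : A, ∃ i, a ∈ obj i

namespace AlgFiltration

section Graded

variable {R A : Type*} [CommRing R] [Ring A] [Algebra R A] (F : AlgFiltration R A)

/-- A filtration is locally finite if each of its terms is a finitely generated module. -/
def IsLocallyFinite : Prop := ∀ i, Module.Finite R (F.obj i)

/-- The preceding term of the filtration, with the convention `A₋₁ = 0`. -/
def below : ℕ → Submodule R A
  | 0 => ⊥
  | i + 1 => F.obj i

theorem mul_mem_below_left {i j : ℕ} {a b : A} (ha : a ∈ F.below i) (hb : b ∈ F.obj j) :
    a * b ∈ F.below (i + j) := by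
  cases i with
  | zero =>
    have h0 : a = 0 := by simpa [below] using ha
    simp [h0]
  | succ i =>
    rw [Nat.succ_add]
    exact F.mul_mem ha hb

theorem mul_mem_below_right {i j : ℕ} {a b : A} (ha : a ∈ F.obj i) (hb : b ∈ F.below j) :
    a * b ∈ F.below (i + j) := by
  cases j with
  | zero =>
    have h0 : b = 0 := by simpa [below] using hb
    simp [h0]
  | succ j => exact F.mul_mem ha hb

/-- The `i`-th graded piece `Aᵢ / Aᵢ₋₁`. -/
def Piece (i : ℕ) : Type _ := F.obj i ⧸ (F.below i).submoduleOf (F.obj i)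

instance (i : ℕ) : AddCommGroup (F.Piece i) :=
  inferInstanceAs (AddCommGroup (F.obj i ⧸ (F.below i).submoduleOf (F.obj i)))

instance {S : Type*} [CommRing S] [Algebra S R] [Algebra S A] [IsScalarTower S R A] (i : ℕ) :
    Module S (F.Piece i) :=
  inferInstanceAs (Module S (F.obj i ⧸ (F.below i).submoduleOf (F.obj i)))

instance {S : Type*} [CommRing S] [Algebra S R] [Algebra S A] [IsScalarTower S R A] (i : ℕ) :
    IsScalarTower S R (F.Piece i) :=
  inferInstanceAs (IsScalarTower S R (F.obj i ⧸ (F.below i).submoduleOf (F.obj i)))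

/-- The class of an element of `Aᵢ` in `Aᵢ / Aᵢ₋₁`. -/
def cls (i : ℕ) (a : A) (ha : a ∈ F.obj i) : F.Piece i :=
  Submodule.Quotient.mk ⟨a, ha⟩

theorem cls_surj {i : ℕ} (p : F.Piece i) : ∃ a, ∃ ha : a ∈ F.obj i, F.cls i a ha = p := by
  induction p using Submodule.Quotient.induction_on with
  | H x => exact ⟨x.1, x.2, rfl⟩

theorem cls_eq_cls {i : ℕ} {a b : A} {ha : a ∈ F.obj i} {hb : b ∈ F.obj i} :
    F.cls i a ha = F.cls i b hb ↔ a - b ∈ F.below i :=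
  Submodule.Quotient.eq _

theorem cls_add {i : ℕ} {a b : A} (ha : a ∈ F.obj i) (hb : b ∈ F.obj i) :
    F.cls i (a + b) (add_mem ha hb) = F.cls i a ha + F.cls i b hb := rfl

theorem cls_zero (i : ℕ) : F.cls i 0 (zero_mem _) = 0 := rfl

/-- The product `Aᵢ / Aᵢ₋₁ × Aⱼ / Aⱼ₋₁ → Aᵢ₊ⱼ / Aᵢ₊ⱼ₋₁` induced by that of `A`. -/
def pieceMul {i j : ℕ} (p : F.Piece i) (r : F.Piece j) : F.Piece (i + j) :=
  Quotient.liftOn₂' p r (fun a b => F.cls (i + j) (a.1 * b.1) (F.mul_mem a.2 b.2)) (by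
    intro a b a' b' ha hb
    rw [Submodule.quotientRel_def] at ha hb
    rw [cls_eq_cls]
    have h : a.1 * b.1 - a'.1 * b'.1 = (a.1 - a'.1) * b.1 + a'.1 * (b.1 - b'.1) := by
      noncomm_ring
    rw [h]
    exact add_mem (F.mul_mem_below_left ha b.2) (F.mul_mem_below_right a'.2 hb))

theorem pieceMul_cls {i j : ℕ} {a b : A} (ha : a ∈ F.obj i) (hb : b ∈ F.obj j) :
    F.pieceMul (F.cls i a ha) (F.cls j b hb) = F.cls (i + j) (a * b) (F.mul_mem ha hb) := rfl

theorem mk_cls_congr {i j : ℕ} {a b : A} (ha : a ∈ F.obj i) (hb : b ∈ F.obj j)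
    (hij : i = j) (hab : a = b) :
    GradedMonoid.mk (A := F.Piece) i (F.cls i a ha) = GradedMonoid.mk j (F.cls j b hb) := by
  subst hij hab; rfl

instance : GradedMonoid.GOne F.Piece := ⟨F.cls 0 1 F.one_mem⟩

instance : GradedMonoid.GMul F.Piece := ⟨fun p r => F.pieceMul p r⟩

theorem gone_eq : (GradedMonoid.GOne.one : F.Piece 0) = F.cls 0 1 F.one_mem := rfl

theorem gmul_cls {i j : ℕ} {a b : A} (ha : a ∈ F.obj i) (hb : b ∈ F.obj j) :
    GradedMonoid.GMul.mul (F.cls i a ha) (F.cls j b hb) =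
      F.cls (i + j) (a * b) (F.mul_mem ha hb) := rfl

instance : GradedMonoid.GMonoid F.Piece where
  one_mul := by
    rintro ⟨i, p⟩
    obtain ⟨a, ha, rfl⟩ := F.cls_surj p
    exact F.mk_cls_congr (F.mul_mem F.one_mem ha) ha (zero_add i) (one_mul a)
  mul_one := by
    rintro ⟨i, p⟩
    obtain ⟨a, ha, rfl⟩ := F.cls_surj p
    exact F.mk_cls_congr (F.mul_mem ha F.one_mem) ha (add_zero i) (mul_one a)
  mul_assoc := by
    rintro ⟨i, p⟩ ⟨j, r⟩ ⟨l, s⟩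
    obtain ⟨a, ha, rfl⟩ := F.cls_surj p
    obtain ⟨b, hb, rfl⟩ := F.cls_surj r
    obtain ⟨c, hc, rfl⟩ := F.cls_surj s
    exact F.mk_cls_congr (F.mul_mem (F.mul_mem ha hb) hc) (F.mul_mem ha (F.mul_mem hb hc))
      (add_assoc i j l) (mul_assoc a b c)

theorem intCast_mem (m : ℤ) : (m : A) ∈ F.obj 0 := by
  have h := (F.obj 0).smul_mem (m : R) F.one_mem
  rwa [Algebra.smul_def, mul_one, map_intCast] at h

theorem natCast_mem (m : ℕ) : (m : A) ∈ F.obj 0 := by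
  have h := F.intCast_mem m
  rwa [Int.cast_natCast] at h

theorem cls_congr {i : ℕ} {a b : A} (ha : a ∈ F.obj i) (hb : b ∈ F.obj i) (hab : a = b) :
    F.cls i a ha = F.cls i b hb := by
  subst hab; rfl

instance : DirectSum.GRing F.Piece where
  mul_zero := by
    intro i j p
    obtain ⟨a, ha, rfl⟩ := F.cls_surj p
    exact F.cls_congr (F.mul_mem ha (zero_mem _)) (zero_mem _) (mul_zero a)
  zero_mul := by
    intro i j p
    obtain ⟨a, ha, rfl⟩ := F.cls_surj p
    exact F.cls_congr (F.mul_mem (zero_mem _) ha) (zero_mem _) (zero_mul a)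
  mul_add := by
    intro i j p r s
    obtain ⟨a, ha, rfl⟩ := F.cls_surj p
    obtain ⟨b, hb, rfl⟩ := F.cls_surj r
    obtain ⟨c, hc, rfl⟩ := F.cls_surj s
    exact F.cls_congr (F.mul_mem ha (add_mem hb hc))
      (add_mem (F.mul_mem ha hb) (F.mul_mem ha hc)) (mul_add a b c)
  add_mul := by
    intro i j p r s
    obtain ⟨a, ha, rfl⟩ := F.cls_surj p
    obtain ⟨b, hb, rfl⟩ := F.cls_surj r
    obtain ⟨c, hc, rfl⟩ := F.cls_surj s
    exact F.cls_congr (F.mul_mem (add_mem ha hb) hc)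
      (add_mem (F.mul_mem ha hc) (F.mul_mem hb hc)) (add_mul a b c)
  natCast m := F.cls 0 m (F.natCast_mem m)
  natCast_zero := F.cls_congr _ (zero_mem _) Nat.cast_zero
  natCast_succ m := F.cls_congr _ (add_mem (F.natCast_mem m) F.one_mem) (Nat.cast_succ m)
  intCast m := F.cls 0 m (F.intCast_mem m)
  intCast_ofNat m := F.cls_congr _ _ (Int.cast_natCast m)
  intCast_negSucc_ofNat m :=
    F.cls_congr _ (neg_mem (F.natCast_mem (m + 1))) (Int.cast_negSucc m)

section Scalars

variable {S : Type*} [CommRing S] [Algebra S R] [Algebra S A] [IsScalarTower S R A]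

theorem algebraMap_mem (s : S) : algebraMap S A s ∈ F.obj 0 := by
  have h := (F.obj 0).smul_mem (algebraMap S R s) F.one_mem
  rwa [algebraMap_smul, ← Algebra.algebraMap_eq_smul_one] at h

theorem smul_mem_obj {i : ℕ} (s : S) {a : A} (ha : a ∈ F.obj i) : s • a ∈ F.obj i := by
  have h := (F.obj i).smul_mem (algebraMap S R s) ha
  rwa [algebraMap_smul] at h

theorem smul_cls {i : ℕ} (s : S) {a : A} (ha : a ∈ F.obj i) :
    s • F.cls i a ha = F.cls i (s • a) (F.smul_mem_obj s ha) := rfl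

/-- The associated graded ring is an algebra over `R`, and more generally over every commutative
ring `S` over which `R` is an algebra. -/
instance : DirectSum.GAlgebra S F.Piece where
  toFun :=
    { toFun := fun s => F.cls 0 (algebraMap S A s) (F.algebraMap_mem s)
      map_zero' := F.cls_congr _ (zero_mem _) (map_zero _)
      map_add' := fun s t =>
        F.cls_congr _ (add_mem (F.algebraMap_mem s) (F.algebraMap_mem t)) (map_add _ s t) }
  map_one := F.cls_congr _ _ (map_one _)
  map_mul s t :=
    F.mk_cls_congr _ (F.mul_mem (F.algebraMap_mem s) (F.algebraMap_mem t)) rfl (map_mul _ s t)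
  commutes := by
    rintro s ⟨i, p⟩
    obtain ⟨a, ha, rfl⟩ := F.cls_surj p
    exact F.mk_cls_congr (F.mul_mem (F.algebraMap_mem s) ha) (F.mul_mem ha (F.algebraMap_mem s))
      (by omega) (Algebra.commutes s a)
  smul_def := by
    rintro s ⟨i, p⟩
    obtain ⟨a, ha, rfl⟩ := F.cls_surj p
    exact F.mk_cls_congr (F.smul_mem_obj s ha) (F.mul_mem (F.algebraMap_mem s) ha)
      (by omega) (Algebra.smul_def s a)

end Scalars

/-- The associated graded ring `gr A = ⨁ᵢ Aᵢ / Aᵢ₋₁`. -/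
abbrev Gr : Type _ := ⨁ i, F.Piece i

/-- The class of `a ∈ Aᵢ` in the degree `i` part of `gr A`. -/
def symbol (i : ℕ) (a : A) (ha : a ∈ F.obj i) : F.Gr :=
  DirectSum.of F.Piece i (F.cls i a ha)

instance {S : Type*} [CommRing S] [Algebra S R] [Algebra S A] [IsScalarTower S R A] :
    IsScalarTower S R F.Gr where
  smul_assoc s r x := by
    ext i
    simp only [DirectSum.smul_apply, smul_assoc]

end Graded

section Induced

variable {D K A : Type*} [CommRing D] [CommRing K] [Ring A] [Algebra D K] [Algebra K A]
  [Algebra D A] [IsScalarTower D K A]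

/-- The filtration `(B ∩ Aᵢ)ᵢ` that a filtration of the `K`-algebra `A` induces on a
`D`-subalgebra `B`. -/
def induced (F : AlgFiltration K A) (B : Subalgebra D A) : AlgFiltration D B where
  obj i := ((F.obj i).restrictScalars D).comap B.val.toLinearMap
  mono _ _ hij _ hx := F.mono hij hx
  one_mem := F.one_mem
  mul_mem ha hb := F.mul_mem ha hb
  exhaustive a := F.exhaustive a.1

theorem induced_below (F : AlgFiltration K A) (B : Subalgebra D A) {i : ℕ} {b : B}
    (hb : b ∈ (F.induced B).below i) : (b : A) ∈ F.below i := by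
  cases i with
  | zero =>
    have h0 : b = 0 := by simpa [below] using hb
    simp [h0]
  | succ i => exact hb

/-- The canonical map `(B ∩ Aᵢ) / (B ∩ Aᵢ₋₁) → Aᵢ / Aᵢ₋₁`. -/
def pieceIncl (F : AlgFiltration K A) (B : Subalgebra D A) (i : ℕ) :
    (F.induced B).Piece i →ₗ[D] F.Piece i :=
  Submodule.liftQ _
    { toFun := fun b => F.cls i b.1.1 b.2
      map_add' := fun _ _ => rfl
      map_smul' := fun _ _ => rfl }
    (by
      intro b hb
      exact (Submodule.Quotient.mk_eq_zero _).2 (F.induced_below B hb))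

/-- The canonical `D`-algebra map `gr B → gr A`. -/
def grIncl (F : AlgFiltration K A) (B : Subalgebra D A) : (F.induced B).Gr →ₐ[D] F.Gr :=
  DirectSum.toAlgebra D _ (fun i => DirectSum.lof D ℕ F.Piece i ∘ₗ F.pieceIncl B i) rfl (by
    intro i j p r
    obtain ⟨a, ha, rfl⟩ := (F.induced B).cls_surj p
    obtain ⟨b, hb, rfl⟩ := (F.induced B).cls_surj r
    exact (DirectSum.of_mul_of (A := F.Piece) (F.cls i a.1 ha) (F.cls j b.1 hb)).symm)

end Induced

end AlgFiltration

/-! ### Congenial algebras -/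

/-- `φ : B → A` exhibits the `D`-algebra `B` as an order of the `K`-algebra `A`: it identifies `B`
with a `D`-subalgebra of `A`, `B` is free over `D`, and `K ⊗ B = A` over `D`. -/
structure IsOrder (K : Type*) {D B A : Type*} [CommRing D] [CommRing K] [Ring B] [Ring A]
    [Algebra D K] [Algebra D B] [Algebra K A] [Algebra D A] [IsScalarTower D K A]
    (φ : B →ₐ[D] A) : Prop where
  injective : Function.Injective φ
  free : Module.Free D B
  baseChange : Function.Bijective (φ.toLinearMap.liftBaseChange K : K ⊗[D] B →ₗ[K] A)

/-- Left and right noetherian. -/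
def IsTwoSidedNoetherian (A : Type*) [Ring A] : Prop :=
  IsNoetherianRing A ∧ IsNoetherianRing Aᵐᵒᵖ

/-- The `D`-algebra `B` is strongly noetherian: `C ⊗ B` over `D` is noetherian for every
commutative noetherian `D`-algebra `C`. -/
def IsStronglyNoetherian.{w, u, v} (D : Type u) (B : Type v) [CommRing D] [Ring B] [Algebra D B] :
    Prop :=
  ∀ (C : Type w) [CommRing C] [Algebra D C], IsNoetherianRing C → IsTwoSidedNoetherian (C ⊗[D] B)

/-- An algebra over a field `k` is PI if it satisfies a nonzero polynomial identity, that is, some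
nonzero noncommutative polynomial over `k` vanishes on it. -/
def IsPIAlgebra (k A : Type*) [CommRing k] [Ring A] [Algebra k A] : Prop :=
  ∃ f : FreeAlgebra k ℕ, f ≠ 0 ∧ ∀ v : ℕ → A, FreeAlgebra.lift k v f = 0

/-- The filtered `k`-algebra `(A, F)` is congenial by means of the finitely generated subring `D`
of `k` and the `D`-subalgebra `B` of `A`. -/
structure IsCongenialVia.{w, u, v} {k : Type u} {A : Type v} [Field k] [Ring A] [Algebra k A]
    (F : AlgFiltration k A) (D : Subalgebra ℤ k) (B : Subalgebra D A) : Prop where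
  locallyFinite : F.IsLocallyFinite
  affine : D.FG
  order : IsOrder k B.val
  order_locallyFinite : (F.induced B).IsLocallyFinite
  gr_order : IsOrder k (F.grIncl B)
  gr_stronglyNoetherian : IsStronglyNoetherian.{w} D (F.induced B).Gr
  gr_locallyFinite : ∀ i, Module.Finite D ((F.induced B).Piece i)
  reduction : ∀ P : Ideal D, P.IsMaximal → Finite (D ⧸ P) →
    Algebra.FiniteType (D ⧸ P) ((D ⧸ P) ⊗[D] B) ∧
    IsTwoSidedNoetherian ((D ⧸ P) ⊗[D] B) ∧
    IsPIAlgebra (D ⧸ P) ((D ⧸ P) ⊗[D] B)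

/-- The `k`-algebra `A` is congenial with respect to the filtration `F`. -/
def IsCongenial.{w, u, v} {k : Type u} {A : Type v} [Field k] [Ring A] [Algebra k A]
    (F : AlgFiltration k A) : Prop :=
  ∃ (D : Subalgebra ℤ k) (B : Subalgebra D A), IsCongenialVia.{w} F D B

/-! ### Filtrations from degrees of generators -/

/-- The filtration obtained by giving degrees `d` to generators `g` of `A`: its `m`-th term is
spanned by the products of generators of total degree at most `m`. -/
def AlgFiltration.ofDegrees {R A ι : Type*} [CommRing R] [Ring A] [Algebra R A]
    (g : ι → A) (d : ι → ℕ) (hg : Algebra.adjoin R (Set.range g) = ⊤) : AlgFiltration R A where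
  obj m := Submodule.span R
    {a | ∃ w : List ι, (w.map d).sum ≤ m ∧ (w.map g).prod = a}
  mono := by
    intro m m' h
    refine Submodule.span_mono ?_
    rintro _ ⟨w, hw, rfl⟩
    exact ⟨w, hw.trans h, rfl⟩
  one_mem := Submodule.subset_span ⟨[], by simp, by simp⟩
  mul_mem := by
    intro i j a b ha hb
    have h := Submodule.mul_mem_mul ha hb
    rw [Submodule.span_mul_span] at h
    refine Submodule.span_mono ?_ h
    rintro _ ⟨_, ⟨w, hw, rfl⟩, _, ⟨w', hw', rfl⟩, rfl⟩
    exact ⟨w ++ w', by simpa using Nat.add_le_add hw hw', by simp⟩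
  exhaustive := by
    intro a
    have ha : a ∈ Submodule.span R (Submonoid.closure (Set.range g) : Set A) := by
      rw [← Algebra.adjoin_eq_span, hg]
      trivial
    have key : ∀ x ∈ (Submonoid.closure (Set.range g) : Set A),
        ∃ w : List ι, (w.map g).prod = x := by
      intro x hx
      induction hx using Submonoid.closure_induction with
      | mem x hx =>
        obtain ⟨i, rfl⟩ := hx
        exact ⟨[i], by simp⟩
      | one => exact ⟨[], rfl⟩
      | mul x y _ _ hx hy =>
        obtain ⟨w, rfl⟩ := hx
        obtain ⟨w', rfl⟩ := hy
        exact ⟨w ++ w', by simp⟩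
    induction ha using Submodule.span_induction with
    | mem x hx =>
      obtain ⟨w, rfl⟩ := key x hx
      exact ⟨_, Submodule.subset_span ⟨w, le_rfl, rfl⟩⟩
    | zero => exact ⟨0, zero_mem _⟩
    | add x y _ _ hx hy =>
      obtain ⟨i, hi⟩ := hx
      obtain ⟨j, hj⟩ := hy
      refine ⟨i + j, add_mem (Submodule.span_mono ?_ hi) (Submodule.span_mono ?_ hj)⟩
      · rintro _ ⟨w, hw, rfl⟩
        exact ⟨w, by omega, rfl⟩
      · rintro _ ⟨w, hw, rfl⟩
        exact ⟨w, by omega, rfl⟩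
    | smul r x _ hx =>
      obtain ⟨i, hi⟩ := hx
      exact ⟨i, Submodule.smul_mem _ r hi⟩

theorem AlgFiltration.gen_mem_ofDegrees {R A ι : Type*} [CommRing R] [Ring A] [Algebra R A]
    (g : ι → A) (d : ι → ℕ) (hg : Algebra.adjoin R (Set.range g) = ⊤) (c : ι) :
    g c ∈ (AlgFiltration.ofDegrees g d hg).obj (d c) :=
  Submodule.subset_span ⟨[c], by simp, by simp⟩

/-! ### Quantum affine spaces -/

/-- The multiparameter matrices `p` with `p_cc = 1` and `p_cd p_dc = 1`. -/
def IsMultiplicativelyAntisymmetric {ι T : Type*} [CommRing T] (p : ι → ι → Tˣ) : Prop :=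
  (∀ c, p c c = 1) ∧ ∀ c d, p c d * p d c = 1

/-- The defining relations `z_c z_d = p_cd z_d z_c` of a quantum affine space. -/
inductive QuantumAffineSpace.Rel {ι T : Type*} [CommRing T] (p : ι → ι → Tˣ) :
    FreeAlgebra T ι → FreeAlgebra T ι → Prop
  | comm (c d : ι) : Rel p (FreeAlgebra.ι T c * FreeAlgebra.ι T d)
      ((p c d : T) • (FreeAlgebra.ι T d * FreeAlgebra.ι T c))

/-- The quantum affine space over `T` with parameters `p`. -/
abbrev QuantumAffineSpace {ι T : Type*} [CommRing T] (p : ι → ι → Tˣ) : Type _ :=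
  RingQuot (QuantumAffineSpace.Rel p)

/-- The coordinate functions of a quantum affine space. -/
def QuantumAffineSpace.z {ι T : Type*} [CommRing T] (p : ι → ι → Tˣ) (c : ι) :
    QuantumAffineSpace p :=
  RingQuot.mkAlgHom T (QuantumAffineSpace.Rel p) (FreeAlgebra.ι T c)

/-! ### Quantized Weyl algebras -/

namespace QuantizedWeyl

variable {T : Type*} [CommRing T] {n : ℕ}

/-- The free generator `xᵢ`. -/
def freeX (T : Type*) [CommRing T] {n : ℕ} (i : Fin n) : FreeAlgebra T (Fin n ⊕ Fin n) :=
  FreeAlgebra.ι T (Sum.inl i)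

/-- The free generator `yᵢ`. -/
def freeY (T : Type*) [CommRing T] {n : ℕ} (i : Fin n) : FreeAlgebra T (Fin n ⊕ Fin n) :=
  FreeAlgebra.ι T (Sum.inr i)

/-- The defining relations of the quantized Weyl algebra. -/
inductive Rel (q : Fin n → Fin n → Tˣ) (γ : Fin n → Tˣ) :
    FreeAlgebra T (Fin n ⊕ Fin n) → FreeAlgebra T (Fin n ⊕ Fin n) → Prop
  | yy (i j : Fin n) : Rel q γ (freeY T i * freeY T j) ((q i j : T) • (freeY T j * freeY T i))
  | xx (i j : Fin n) (h : i < j) :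
      Rel q γ (freeX T i * freeX T j) ((γ i * q i j : T) • (freeX T j * freeX T i))
  | xy_lt (i j : Fin n) (h : i < j) :
      Rel q γ (freeX T i * freeY T j) ((q j i : T) • (freeY T j * freeX T i))
  | xy_gt (i j : Fin n) (h : j < i) :
      Rel q γ (freeX T i * freeY T j) ((γ j * q j i : T) • (freeY T j * freeX T i))
  | xy_eq (j : Fin n) :
      Rel q γ (freeX T j * freeY T j)
        (1 + (γ j : T) • (freeY T j * freeX T j) +
          ∑ l ∈ Finset.univ.filter (· < j), ((γ l : T) - 1) • (freeY T l * freeX T l))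

end QuantizedWeyl

/-- The quantized Weyl algebra with parameters `q` and `γ` over `T`. -/
abbrev QuantizedWeyl {T : Type*} [CommRing T] {n : ℕ} (q : Fin n → Fin n → Tˣ) (γ : Fin n → Tˣ) :
    Type _ :=
  RingQuot (QuantizedWeyl.Rel q γ)

namespace QuantizedWeyl

variable {T : Type*} [CommRing T] {n : ℕ} (q : Fin n → Fin n → Tˣ) (γ : Fin n → Tˣ)

/-- The generators of the quantized Weyl algebra: `gen (inl i)` is `xᵢ` and `gen (inr i)` is
`yᵢ`. -/
def gen (c : Fin n ⊕ Fin n) : QuantizedWeyl q γ :=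
  RingQuot.mkAlgHom T (Rel q γ) (FreeAlgebra.ι T c)

/-- `deg xᵢ = deg yᵢ = i`, where `i` runs through `1, …, n` (so the index `i : Fin n`, which starts
from `0`, is shifted). -/
def deg (c : Fin n ⊕ Fin n) : ℕ := Sum.elim (fun i : Fin n => (i : ℕ) + 1) (fun i : Fin n => (i : ℕ) + 1) c

theorem adjoin_gen : Algebra.adjoin T (Set.range (gen q γ)) = ⊤ := by
  have h : Set.range (gen q γ) =
      (RingQuot.mkAlgHom T (Rel q γ)) '' Set.range (FreeAlgebra.ι T) := by
    rw [← Set.range_comp]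
    rfl
  rw [h, ← AlgHom.map_adjoin, FreeAlgebra.adjoin_range_ι, Algebra.map_top,
    AlgHom.range_eq_top]
  exact RingQuot.mkAlgHom_surjective T _

/-- The standard filtration of the quantized Weyl algebra, with `deg xᵢ = deg yᵢ = i`. -/
def filtration : AlgFiltration T (QuantizedWeyl q γ) :=
  AlgFiltration.ofDegrees (gen q γ) deg (adjoin_gen q γ)

theorem gen_mem (c : Fin n ⊕ Fin n) : gen q γ c ∈ (filtration q γ).obj (deg c) :=
  AlgFiltration.gen_mem_ofDegrees _ _ _ c

section Order

variable {k : Type*} [Field k] {n : ℕ} (q : Fin n → Fin n → kˣ) (γ : Fin n → kˣ)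

/-- The subring of `k` generated by the `q_ij`, the `γ_i` and the `γ_i⁻¹`. -/
def coeffRing : Subalgebra ℤ k :=
  Algebra.adjoin ℤ ((Set.range fun ij : Fin n × Fin n => (q ij.1 ij.2 : k)) ∪
    (Set.range fun i => (γ i : k)) ∪ Set.range fun i => ((γ i)⁻¹ : k))

/-- The subalgebra, over the coefficient ring, generated by the `xᵢ` and `yᵢ`. -/
def integralForm : Subalgebra (coeffRing q γ) (QuantizedWeyl q γ) :=
  Algebra.adjoin (coeffRing q γ) (Set.range (gen q γ))

/-- The generators as elements of the integral form. -/
def integralGen (c : Fin n ⊕ Fin n) : integralForm q γ :=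
  ⟨gen q γ c, Algebra.subset_adjoin ⟨c, rfl⟩⟩

theorem integralGen_mem (c : Fin n ⊕ Fin n) :
    integralGen q γ c ∈ ((filtration q γ).induced (integralForm q γ)).obj (deg c) :=
  gen_mem q γ c

end Order

end QuantizedWeyl

end

universe w

/-! Everything follows from one Poincaré–Birkhoff–Witt basis, the ordered monomials `y^α x^β`, and
from its compatibility with the filtration.

Spanning. Any two generators commute up to a unit of `D`, except `x_j` and `y_j`, whose commutation
rule has the extra term `1 + ∑_{l<j} (γ_l - 1) y_l x_l`. Since the degrees increase with the index,
this term has degree less than `2j`. Sorting a word therefore costs a unit and an error of lower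
degree, and by induction each term of the filtration is the span of the ordered monomials of bounded
degree (`AlgFiltration.ofDegrees_obj_eq_span`).

Independence. The algebra acts on a Fock space, `y_i` raising and `x_i` lowering exponents. The
monomials act independently if the `q`-integers of the `γ_i` do not vanish
(`linearIndependent_orderedMonomial_fock`). They may vanish when `γ_i` is a root of unity, so `γ_i`
is first deformed to `γ_i + X` over the power series ring; the resulting basis is then specialised
at `X = 0` (`linearIndependent_gen`).

Consequences. The same monomials form a basis of `A_D` over `D` and of `A` over `k`, and their
symbols form bases of the graded rings. Hence the inclusions are orders (`IsOrder.of_basis`), and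
the graded rings, whose generators commute up to units, are quantum affine spaces
(`QuantumAffineSpace.lift_bijective`). Strong noetherianity is Hilbert's basis theorem transported
by leading monomials (`isNoetherianRing_of_monomial_mul`). Over a finite field some `N` satisfies
`u^N = 1` and `1 + u + ⋯ + u^(N-1) = 0` for all units `u`. The `N`-th powers of the generators are
then central, and the reduction is a finite module over a polynomial ring, so it is noetherian and
satisfies a standard identity. -/

/-! ### Ordered monomials -/

section OrderedMonomial

variable {ι T S : Type*} [CommRing T] [Ring S] [Algebra T S]

/-- The word in which the letters of `L` occur in the order of `L`, with multiplicities `a`. -/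
def orderedWord (L : List ι) (a : ι →₀ ℕ) : List ι :=
  L.flatMap fun c => List.replicate (a c) c

/-- The product of the powers `g c ^ a c`, taken in the order of the list `L`. -/
def orderedMonomial (L : List ι) (g : ι → S) (a : ι →₀ ℕ) : S :=
  (L.map fun c => g c ^ a c).prod

theorem prod_map_orderedWord (L : List ι) (g : ι → S) (a : ι →₀ ℕ) :
    ((orderedWord L a).map g).prod = orderedMonomial L g a := by
  induction L with
  | nil => simp [orderedWord, orderedMonomial]
  | cons c L ih =>
    simp only [orderedWord, orderedMonomial] at ih
    simp [orderedWord, orderedMonomial, ih]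

theorem map_orderedMonomial {S' F : Type*} [Ring S'] [FunLike F S S'] [MonoidHomClass F S S']
    (φ : F) (L : List ι) (g : ι → S) (a : ι →₀ ℕ) :
    φ (orderedMonomial L g a) = orderedMonomial L (fun c => φ (g c)) a := by
  simp [orderedMonomial, map_list_prod, Function.comp_def]

/-- The degree of the ordered monomial with exponents `a`, for generators of degrees `d`. -/
def wordDegree (L : List ι) (d : ι → ℕ) (a : ι →₀ ℕ) : ℕ :=
  ((orderedWord L a).map d).sum

variable [DecidableEq ι]

theorem count_orderedWord {L : List ι} (hL : ∀ c, L.count c = 1) (a : ι →₀ ℕ) (c : ι) :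
    (orderedWord L a).count c = a c := by
  have key : ∀ L : List ι, (orderedWord L a).count c = L.count c * a c := by
    intro L
    induction L with
    | nil => simp [orderedWord]
    | cons b L ih =>
      simp only [orderedWord] at ih
      by_cases h : b = c
      · subst h
        simp only [orderedWord, List.flatMap_cons, List.count_append, ih, List.count_replicate_self,
          List.count_cons_self]
        ring
      · simp [orderedWord, ih, List.count_replicate, h]
  rw [key, hL, one_mul]

theorem exists_perm_orderedWord {L : List ι} (hL : ∀ c, L.count c = 1) (w : List ι) :
    ∃ a, w.Perm (orderedWord L a) := by
  refine ⟨Multiset.toFinsupp (w : Multiset ι), List.perm_iff_count.2 fun c => ?_⟩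
  rw [count_orderedWord hL]
  simp

theorem orderedWord_add_perm {L : List ι} (hL : ∀ c, L.count c = 1) (a b : ι →₀ ℕ) :
    (orderedWord L a ++ orderedWord L b).Perm (orderedWord L (a + b)) := by
  refine List.perm_iff_count.2 fun c => ?_
  rw [List.count_append, count_orderedWord hL, count_orderedWord hL, count_orderedWord hL]
  rfl

end OrderedMonomial

/-! ### Sorting words in generators that commute up to units -/

section Commutation

variable {ι T S : Type*} [CommRing T] [Ring S] [Algebra T S]

theorem exists_units_smul_of_perm {g : ι → S}
    (hg : ∀ c c', ∃ u : Tˣ, g c * g c' = (u : T) • (g c' * g c)) {w w' : List ι}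
    (h : w.Perm w') : ∃ u : Tˣ, (w.map g).prod = (u : T) • (w'.map g).prod := by
  induction h with
  | nil => exact ⟨1, by simp⟩
  | cons c _ ih =>
    obtain ⟨u, hu⟩ := ih
    exact ⟨u, by simp [hu]⟩
  | swap c c' l =>
    obtain ⟨u, hu⟩ := hg c' c
    exact ⟨u, by simp only [List.map_cons, List.prod_cons, ← mul_assoc, hu, smul_mul_assoc]⟩
  | trans _ _ ih ih' =>
    obtain ⟨u, hu⟩ := ih
    obtain ⟨v, hv⟩ := ih'
    exact ⟨u * v, by rw [hu, hv, smul_smul, Units.val_mul]⟩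

theorem exists_orderedMonomial_mul [DecidableEq ι] {g : ι → S}
    (hg : ∀ c c', ∃ u : Tˣ, g c * g c' = (u : T) • (g c' * g c)) {L : List ι}
    (hL : ∀ c, L.count c = 1) (a b : ι →₀ ℕ) :
    ∃ u : Tˣ, orderedMonomial L g a * orderedMonomial L g b =
      (u : T) • orderedMonomial L g (a + b) := by
  obtain ⟨u, hu⟩ := exists_units_smul_of_perm hg (orderedWord_add_perm hL a b)
  refine ⟨u, ?_⟩
  rwa [List.map_append, List.prod_append, prod_map_orderedWord, prod_map_orderedWord,
    prod_map_orderedWord] at hu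

theorem span_orderedMonomial_eq_top [DecidableEq ι] {g : ι → S}
    (htop : Algebra.adjoin T (Set.range g) = ⊤)
    (hg : ∀ c c', ∃ u : Tˣ, g c * g c' = (u : T) • (g c' * g c)) {L : List ι}
    (hL : ∀ c, L.count c = 1) :
    Submodule.span T (Set.range (orderedMonomial L g)) = ⊤ := by
  rw [eq_top_iff]
  rintro s -
  -- With all degrees zero the filtration only serves to write `s` as a combination of words.
  have hs := (AlgFiltration.ofDegrees g 0 htop).exhaustive s
  obtain ⟨m, hm⟩ := hs
  refine Submodule.span_le.2 ?_ hm
  rintro _ ⟨w, -, rfl⟩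
  obtain ⟨a, ha⟩ := exists_perm_orderedWord hL w
  obtain ⟨u, hu⟩ := exists_units_smul_of_perm hg ha
  rw [hu, prod_map_orderedWord]
  exact Submodule.smul_mem _ _ (Submodule.subset_span ⟨a, rfl⟩)

end Commutation

/-! ### Sorting words modulo lower terms of a filtration -/

namespace AlgFiltration

section OfDegrees

variable {ι T S : Type*} [CommRing T] [Ring S] [Algebra T S]

theorem obj_le_below (F : AlgFiltration T S) {i j : ℕ} (h : i < j) : F.obj i ≤ F.below j := by
  cases j with
  | zero => omega
  | succ j => exact F.mono (Nat.le_of_lt_succ h)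

theorem prod_map_mem (F : AlgFiltration T S) {g : ι → S} {d : ι → ℕ}
    (hg : ∀ c, g c ∈ F.obj (d c)) (w : List ι) : (w.map g).prod ∈ F.obj (w.map d).sum := by
  induction w with
  | nil => exact F.one_mem
  | cons c w ih => simpa using F.mul_mem (hg c) ih

/-- A permutation is a chain of adjacent swaps. Each swap contributes a unit and an error that stays
of lower degree after multiplication by the rest of the word. -/
theorem exists_prod_sub_smul_mem_below (F : AlgFiltration T S) {g : ι → S} {d : ι → ℕ}
    (hg : ∀ c, g c ∈ F.obj (d c))
    (hcomm : ∀ c c', ∃ u : Tˣ, g c * g c' - (u : T) • (g c' * g c) ∈ F.below (d c + d c'))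
    {w w' : List ι} (h : w.Perm w') :
    ∃ u : Tˣ, (w.map g).prod - (u : T) • (w'.map g).prod ∈ F.below (w.map d).sum := by
  induction h with
  | nil => exact ⟨1, by simp⟩
  | cons c _ ih =>
    obtain ⟨u, hu⟩ := ih
    refine ⟨u, ?_⟩
    have := F.mul_mem_below_right (hg c) hu
    simpa [mul_sub] using this
  | swap c c' l =>
    obtain ⟨u, hu⟩ := hcomm c' c
    refine ⟨u, ?_⟩
    have := F.mul_mem_below_left hu (F.prod_map_mem hg l)
    simpa [sub_mul, mul_assoc, add_assoc] using this
  | trans h₁ _ ih ih' =>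
    obtain ⟨u, hu⟩ := ih
    obtain ⟨v, hv⟩ := ih'
    refine ⟨u * v, ?_⟩
    -- The degree of a word is invariant under permutation, so both errors lie in the same term of
    -- the filtration.
    rw [← (h₁.map d).sum_eq] at hv
    have := add_mem hu (Submodule.smul_mem _ (u : T) hv)
    simpa [smul_sub, smul_smul] using this

/-- Sorting a word replaces it by a unit multiple of an ordered monomial of the same degree, plus an
element of a strictly smaller term of the filtration, to which strong induction applies. -/
theorem ofDegrees_obj_eq_span [DecidableEq ι] {g : ι → S} {d : ι → ℕ}
    (htop : Algebra.adjoin T (Set.range g) = ⊤)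
    (hcomm : ∀ c c', ∃ u : Tˣ,
      g c * g c' - (u : T) • (g c' * g c) ∈ (ofDegrees g d htop).below (d c + d c'))
    {L : List ι} (hL : ∀ c, L.count c = 1) (m : ℕ) :
    (ofDegrees g d htop).obj m =
      Submodule.span T (orderedMonomial L g '' {a | wordDegree L d a ≤ m}) := by
  refine le_antisymm ?_ (Submodule.span_le.2 ?_)
  · induction m using Nat.strong_induction_on with
    | _ m ih =>
      refine Submodule.span_le.2 ?_
      rintro _ ⟨w, hw, rfl⟩
      obtain ⟨a, ha⟩ := exists_perm_orderedWord hL w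
      obtain ⟨u, hu⟩ := (ofDegrees g d htop).exists_prod_sub_smul_mem_below
        (gen_mem_ofDegrees g d htop) hcomm ha
      have hdeg : wordDegree L d a = (w.map d).sum := ((ha.map d).sum_eq).symm
      rw [prod_map_orderedWord] at hu
      have hlow : (ofDegrees g d htop).below (w.map d).sum ≤
          Submodule.span T (orderedMonomial L g '' {a | wordDegree L d a ≤ m}) := by
        generalize (w.map d).sum = j at hw
        cases j with
        | zero => exact bot_le
        | succ j =>
          refine (ih j hw).trans (Submodule.span_mono (Set.image_mono fun b (hb : _ ≤ j) => ?_))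
          change _ ≤ m
          omega
      have hmem : orderedMonomial L g a ∈
          Submodule.span T (orderedMonomial L g '' {a | wordDegree L d a ≤ m}) :=
        Submodule.subset_span ⟨a, by simpa [hdeg] using hw, rfl⟩
      have := add_mem (hlow hu) (Submodule.smul_mem _ (u : T) hmem)
      simpa using this
  · rintro _ ⟨a, ha, rfl⟩
    exact Submodule.subset_span ⟨orderedWord L a, ha, prod_map_orderedWord L g a⟩

/-- Positive degrees bound the length of a word by its degree, and there are finitely many words of
bounded length. -/
theorem ofDegrees_isLocallyFinite [Finite ι] {g : ι → S} {d : ι → ℕ}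
    (htop : Algebra.adjoin T (Set.range g) = ⊤) (hd : ∀ c, 1 ≤ d c) :
    (ofDegrees g d htop).IsLocallyFinite := by
  intro m
  refine Module.Finite.of_fg (Submodule.fg_span ?_)
  refine ((List.finite_length_le ι m).image fun w => (w.map g).prod).subset ?_
  rintro _ ⟨w, hw, rfl⟩
  refine ⟨w, le_trans ?_ hw, rfl⟩
  simpa using List.length_le_sum_of_one_le (w.map d) (by simpa using fun c _ => hd c)

theorem span_range_eq_top (F : AlgFiltration T S) {I : Type*} {e : I → S} {δ : I → ℕ}
    (h : ∀ m, F.obj m = Submodule.span T (e '' {a | δ a ≤ m})) :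
    Submodule.span T (Set.range e) = ⊤ := by
  rw [eq_top_iff]
  rintro s -
  obtain ⟨m, hm⟩ := F.exhaustive s
  rw [h] at hm
  exact Submodule.span_mono (Set.image_subset_range _ _) hm

end OfDegrees

end AlgFiltration

/-! ### Bases of associated graded rings, and orders -/

section MapRepr

variable {D K A B I : Type*} [CommRing D] [CommRing K] [Ring A] [Ring B] [Algebra D K]
  [Algebra K A] [Algebra D A] [IsScalarTower D K A] [Algebra D B]

theorem Module.Basis.repr_map_eq_algebraMap (b : Module.Basis I D B) (b' : Module.Basis I K A)
    (φ : B →ₐ[D] A) (hφ : ∀ a, φ (b a) = b' a) (s : B) (a : I) :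
    b'.repr (φ s) a = algebraMap D K (b.repr s a) := by
  classical
  have : (b'.coord a).restrictScalars D ∘ₗ φ.toLinearMap =
      Algebra.linearMap D K ∘ₗ b.coord a := by
    refine b.ext fun c => ?_
    simp [hφ, Finsupp.single_apply, apply_ite (algebraMap D K)]
  exact LinearMap.congr_fun this s

end MapRepr

namespace AlgFiltration

section GradedBasis

variable {T S I : Type*} [CommRing T] [Ring S] [Algebra T S] (F : AlgFiltration T S)

theorem below_eq_span {e : I → S} {δ : I → ℕ}
    (h : ∀ m, F.obj m = Submodule.span T (e '' {a | δ a ≤ m})) (m : ℕ) :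
    F.below m = Submodule.span T (e '' {a | δ a < m}) := by
  cases m with
  | zero => simp [below]
  | succ m => simp only [below, h, Nat.lt_succ_iff]

theorem mem_obj_of_obj_eq_span {e : I → S} {δ : I → ℕ}
    (h : ∀ m, F.obj m = Submodule.span T (e '' {a | δ a ≤ m})) (a : I) : e a ∈ F.obj (δ a) := by
  rw [h]
  exact Submodule.subset_span ⟨a, le_refl (δ a), rfl⟩

theorem symbol_add {i : ℕ} {s t : S} (hs : s ∈ F.obj i) (ht : t ∈ F.obj i) :
    F.symbol i (s + t) (add_mem hs ht) = F.symbol i s hs + F.symbol i t ht := by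
  rw [symbol, cls_add, map_add]
  rfl

theorem symbol_smul {i : ℕ} (r : T) {s : S} (hs : s ∈ F.obj i) :
    F.symbol i (r • s) ((F.obj i).smul_mem r hs) = r • F.symbol i s hs :=
  (DirectSum.lof T ℕ F.Piece i).map_smul r (F.cls i s hs)

theorem symbol_eq_symbol {i : ℕ} {s t : S} {hs : s ∈ F.obj i} {ht : t ∈ F.obj i}
    (h : s - t ∈ F.below i) : F.symbol i s hs = F.symbol i t ht :=
  congrArg _ (F.cls_eq_cls.2 h)

theorem symbol_eq_zero {i : ℕ} {s : S} {hs : s ∈ F.obj i} (h : s ∈ F.below i) :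
    F.symbol i s hs = 0 := by
  rw [F.symbol_eq_symbol (ht := zero_mem _) (by simpa using h), symbol, cls_zero, map_zero]

theorem symbol_congr {i j : ℕ} {s t : S} (hs : s ∈ F.obj i) (ht : t ∈ F.obj j)
    (hij : i = j) (hst : s = t) : F.symbol i s hs = F.symbol j t ht := by
  subst hij hst
  rfl

theorem symbol_mul {i j : ℕ} {s t : S} (hs : s ∈ F.obj i) (ht : t ∈ F.obj j) :
    F.symbol i s hs * F.symbol j t ht = F.symbol (i + j) (s * t) (F.mul_mem hs ht) :=
  DirectSum.of_mul_of (A := F.Piece) (F.cls i s hs) (F.cls j t ht)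

theorem prod_map_symbol {ι : Type*} {g : ι → S} {d : ι → ℕ} (hg : ∀ c, g c ∈ F.obj (d c))
    (w : List ι) :
    (w.map fun c => F.symbol (d c) (g c) (hg c)).prod =
      F.symbol (w.map d).sum (w.map g).prod (F.prod_map_mem hg w) := by
  induction w with
  | nil => rfl
  | cons c w ih =>
    rw [List.map_cons, List.prod_cons, ih, symbol_mul]
    exact F.symbol_congr _ _ (by simp) (by simp)

theorem orderedMonomial_symbol {ι : Type*} {g : ι → S} {d : ι → ℕ} (hg : ∀ c, g c ∈ F.obj (d c))
    (L : List ι) (a : ι →₀ ℕ) (ha : orderedMonomial L g a ∈ F.obj (wordDegree L d a)) :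
    orderedMonomial L (fun c => F.symbol (d c) (g c) (hg c)) a =
      F.symbol (wordDegree L d a) (orderedMonomial L g a) ha := by
  rw [← prod_map_orderedWord, prod_map_symbol]
  exact F.symbol_congr _ _ rfl (prod_map_orderedWord L g a)

variable {e : I → S} {δ : I → ℕ}

/-- In degree `i`, the spanning elements with `δ a < i` die and those with `δ a = i` give the listed
symbols. -/
theorem span_symbol_eq_top (h : ∀ m, F.obj m = Submodule.span T (e '' {a | δ a ≤ m})) :
    Submodule.span T
      (Set.range fun a => F.symbol (δ a) (e a) (F.mem_obj_of_obj_eq_span h a)) = ⊤ := by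
  set M := Submodule.span T
      (Set.range fun a => F.symbol (δ a) (e a) (F.mem_obj_of_obj_eq_span h a))
  have key : ∀ (i : ℕ) (s : S) (hs : s ∈ F.obj i), F.symbol i s hs ∈ M := by
    intro i s hs
    have hs' : s ∈ Submodule.span T (e '' {a | δ a ≤ i}) := h i ▸ hs
    -- The symbol depends on the membership proof, so the induction over the span has to carry that
    -- proof along.
    have : ∃ hs : s ∈ F.obj i, F.symbol i s hs ∈ M := by
      clear hs
      induction hs' using Submodule.span_induction with
      | mem x hx =>
        obtain ⟨a, ha : δ a ≤ i, rfl⟩ := hx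
        have hmem := F.mono ha (F.mem_obj_of_obj_eq_span h a)
        refine ⟨hmem, ?_⟩
        rcases ha.lt_or_eq with hlt | rfl
        · rw [F.symbol_eq_zero (F.obj_le_below hlt (F.mem_obj_of_obj_eq_span h a))]
          exact zero_mem _
        · exact Submodule.subset_span ⟨a, rfl⟩
      | zero => exact ⟨zero_mem _, by rw [F.symbol_eq_zero (zero_mem _)]; exact zero_mem _⟩
      | add x y _ _ hx hy =>
        obtain ⟨hx, hx'⟩ := hx
        obtain ⟨hy, hy'⟩ := hy
        exact ⟨add_mem hx hy, by rw [F.symbol_add hx hy]; exact add_mem hx' hy'⟩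
      | smul r x _ hx =>
        obtain ⟨hx, hx'⟩ := hx
        exact ⟨Submodule.smul_mem _ r hx, by rw [F.symbol_smul r hx]; exact M.smul_mem r hx'⟩
    exact this.2
  rw [eq_top_iff]
  rintro x -
  induction x using DirectSum.induction_on with
  | zero => exact zero_mem _
  | of i p =>
    obtain ⟨s, hs, rfl⟩ := F.cls_surj p
    exact key i s hs
  | add x y hx hy => exact add_mem hx hy

/-- The coordinates at the indices with `δ a = i` vanish on the span of the `e a` with `δ a < i`,
hence descend to the `i`-th piece. Together they define a linear map on the graded ring that sends
the symbols to the standard basis vectors. -/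
theorem linearIndependent_symbol (he : LinearIndependent T e)
    (h : ∀ m, F.obj m = Submodule.span T (e '' {a | δ a ≤ m})) :
    LinearIndependent T fun a => F.symbol (δ a) (e a) (F.mem_obj_of_obj_eq_span h a) := by
  classical
  let b : Module.Basis I T S := .mk he (F.span_range_eq_top h).ge
  let r (i : ℕ) : S →ₗ[T] I →₀ T :=
    (Finsupp.lmapDomain T T Subtype.val) ∘ₗ
      (Finsupp.lsubtypeDomain (M := T) (R := T) {a | δ a = i}) ∘ₗ b.repr.toLinearMap
  have hr (i : ℕ) (a : I) : r i (e a) = if δ a = i then Finsupp.single a 1 else 0 := by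
    have hb : b.repr (e a) = Finsupp.single a 1 := by
      rw [← Module.Basis.mk_apply he (F.span_range_eq_top h).ge a]
      exact b.repr_self a
    simp only [r, LinearMap.comp_apply, LinearEquiv.coe_coe, hb, Finsupp.lsubtypeDomain_apply,
      Finsupp.lmapDomain_apply]
    split_ifs with hi
    · have : Finsupp.subtypeDomain (· ∈ {a | δ a = i}) (Finsupp.single a (1 : T)) =
          Finsupp.single ⟨a, hi⟩ 1 := by
        ext ⟨x, hx⟩
        simp [Finsupp.single_apply, Subtype.ext_iff]
      rw [this, Finsupp.mapDomain_single]
    · have : Finsupp.subtypeDomain (· ∈ {a | δ a = i}) (Finsupp.single a (1 : T)) = 0 := by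
        ext ⟨x, hx⟩
        have : a ≠ x := by rintro rfl; exact hi hx
        simp [this]
      rw [this, Finsupp.mapDomain_zero]
  have hker (i : ℕ) : F.below i ≤ LinearMap.ker (r i) := by
    rw [F.below_eq_span h, Submodule.span_le]
    rintro _ ⟨a, ha : δ a < i, rfl⟩
    simp [hr, ha.ne]
  let R (i : ℕ) : F.Piece i →ₗ[T] I →₀ T :=
    Submodule.liftQ _ (r i ∘ₗ (F.obj i).subtype) (fun s hs => hker i hs)
  have hR (i : ℕ) (s : S) (hs : s ∈ F.obj i) :
      DirectSum.toModule T ℕ _ R (F.symbol i s hs) = r i s :=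
    DirectSum.toModule_lof T i (F.cls i s hs)
  refine LinearIndependent.of_comp (DirectSum.toModule T ℕ _ R) ?_
  have : (DirectSum.toModule T ℕ _ R ∘ fun a =>
      F.symbol (δ a) (e a) (F.mem_obj_of_obj_eq_span h a)) = fun a => Finsupp.single a 1 := by
    funext a
    simp [hR, hr]
  rw [this]
  exact Finsupp.linearIndependent_single_one T I

theorem isLocallyFinite_piece (hF : F.IsLocallyFinite) (i : ℕ) : Module.Finite T (F.Piece i) :=
  have := hF i
  Module.Finite.of_surjective ((F.below i).submoduleOf (F.obj i)).mkQ
    (Submodule.mkQ_surjective _)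

end GradedBasis

section InducedBasis

variable {D K A I : Type*} [CommRing D] [CommRing K] [Ring A] [Algebra D K] [Algebra K A]
  [Algebra D A] [IsScalarTower D K A]

/-- Membership in the span of part of a basis is a condition on the support of the coordinates. The
coordinates over `K` of an element of `B` are the images of those over `D`, so the two supports
agree. -/
theorem induced_obj_eq_span (F : AlgFiltration K A) (B : Subalgebra D A)
    (hDK : Function.Injective (algebraMap D K)) (b : Module.Basis I D B) (b' : Module.Basis I K A)
    (hb : ∀ a, (b a : A) = b' a) {δ : I → ℕ}
    (h : ∀ m, F.obj m = Submodule.span K (b' '' {a | δ a ≤ m})) (m : ℕ) :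
    (F.induced B).obj m = Submodule.span D (b '' {a | δ a ≤ m}) := by
  ext s
  have hrepr : ∀ (s : B) (a : I), b'.repr s a = algebraMap D K (b.repr s a) := by
    exact b.repr_map_eq_algebraMap b' B.val hb
  have h1 : s ∈ (F.induced B).obj m ↔ (s : A) ∈ F.obj m := Iff.rfl
  rw [h1, h, b'.mem_span_image, b.mem_span_image]
  have : (b'.repr (s : A)).support = (b.repr s).support := by
    ext a
    simp [hrepr, map_eq_zero_iff _ hDK]
  rw [this]

theorem grIncl_symbol (F : AlgFiltration K A) (B : Subalgebra D A) {i : ℕ} {s : B}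
    (hs : s ∈ (F.induced B).obj i) :
    F.grIncl B ((F.induced B).symbol i s hs) = F.symbol i (s : A) hs :=
  DirectSum.toModule_lof D i _

end InducedBasis

end AlgFiltration

section Order

variable {D K A B I : Type*} [CommRing D] [CommRing K] [Ring A] [Ring B] [Algebra D K]
  [Algebra K A] [Algebra D A] [IsScalarTower D K A] [Algebra D B]

/-- A map that carries a `D`-basis to a `K`-basis is injective on coordinates, and its extension to
`K ⊗ B` carries a basis to a basis. -/
theorem IsOrder.of_basis (hDK : Function.Injective (algebraMap D K)) (b : Module.Basis I D B)
    (b' : Module.Basis I K A) (φ : B →ₐ[D] A) (hφ : ∀ a, φ (b a) = b' a) : IsOrder K φ where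
  injective := by
    rw [injective_iff_map_eq_zero]
    intro s hs
    refine b.ext_elem fun a => hDK ?_
    rw [← b.repr_map_eq_algebraMap b' φ hφ, hs]
    simp
  free := Module.Free.of_basis b
  baseChange := by
    have : φ.toLinearMap.liftBaseChange K = (b.baseChange K).equiv b' (Equiv.refl I) := by
      refine (b.baseChange K).ext fun a => ?_
      rw [LinearEquiv.coe_coe, Module.Basis.equiv_apply]
      simp [hφ]
    rw [← LinearMap.coe_coe, this]
    exact LinearEquiv.bijective _

end Order

/-! ### Quantum affine spaces -/

namespace QuantumAffineSpace

variable {ι T : Type*} [CommRing T] (p : ι → ι → Tˣ)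

theorem z_mul_z (c c' : ι) : z p c * z p c' = (p c c' : T) • (z p c' * z p c) := by
  have := RingQuot.mkAlgHom_rel T (Rel.comm (p := p) c c')
  simpa [z] using this

theorem adjoin_z : Algebra.adjoin T (Set.range (z p)) = ⊤ := by
  have h : Set.range (z p) =
      (RingQuot.mkAlgHom T (Rel p)) '' Set.range (FreeAlgebra.ι T) := by
    rw [← Set.range_comp]
    rfl
  rw [h, ← AlgHom.map_adjoin, FreeAlgebra.adjoin_range_ι, Algebra.map_top,
    AlgHom.range_eq_top]
  exact RingQuot.mkAlgHom_surjective T _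

variable {S : Type*} [Ring S] [Algebra T S]

/-- The algebra map out of a quantum affine space given by elements that satisfy its relations. -/
noncomputable def lift (g : ι → S) (hg : ∀ c c', g c * g c' = (p c c' : T) • (g c' * g c)) :
    QuantumAffineSpace p →ₐ[T] S :=
  RingQuot.liftAlgHom T ⟨FreeAlgebra.lift T g, by
    rintro _ _ ⟨c, c'⟩
    simpa using hg c c'⟩

@[simp]
theorem lift_z (g : ι → S) (hg : ∀ c c', g c * g c' = (p c c' : T) • (g c' * g c)) (c : ι) :
    lift p g hg (z p c) = g c := by
  simp [lift, z]

/-- The ordered monomials of the quantum affine space span it by sorting, and they are independent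
because their images are. So the map carries a basis to a basis, and no separate proof of
independence in the quantum affine space is needed. -/
theorem lift_bijective [DecidableEq ι] (g : ι → S)
    (hg : ∀ c c', g c * g c' = (p c c' : T) • (g c' * g c)) {L : List ι}
    (hL : ∀ c, L.count c = 1) (hli : LinearIndependent T (orderedMonomial L g))
    (hspan : Submodule.span T (Set.range (orderedMonomial L g)) = ⊤) :
    Function.Bijective (lift p g hg) := by
  have hmap : ∀ a, lift p g hg (orderedMonomial L (z p) a) = orderedMonomial L g a := by
    intro a
    simp [map_orderedMonomial]
  have hz := span_orderedMonomial_eq_top (adjoin_z p) (fun c c' => ⟨p c c', z_mul_z p c c'⟩) hL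
  have hliz : LinearIndependent T (orderedMonomial L (z p)) := by
    refine LinearIndependent.of_comp (lift p g hg).toLinearMap ?_
    convert hli using 1
    funext a
    exact hmap a
  let b : Module.Basis _ T _ := .mk hliz hz.ge
  let b' : Module.Basis _ T _ := .mk hli hspan.ge
  have : (lift p g hg).toLinearMap = b.equiv b' (Equiv.refl _) := by
    refine b.ext fun a => ?_
    rw [LinearEquiv.coe_coe, Module.Basis.equiv_apply]
    simp [b, b', hmap]
  have h2 : (⇑(lift p g hg) : _ → S) = b.equiv b' (Equiv.refl _) := by
    rw [← AlgHom.coe_toLinearMap, this]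
    rfl
  rw [h2]
  exact LinearEquiv.bijective _

end QuantumAffineSpace

/-! ### Noetherianity of twisted monomial algebras -/

section TwistedNoetherian

variable {ι C S : Type*} [CommRing C] [Ring S] [Algebra C S]

/-- The span of the monomials that precede `a` in the monomial order. -/
def MonomialOrder.lower (m : MonomialOrder ι) (C : Type*) [CommRing C] [Algebra C S]
    (e : (ι →₀ ℕ) → S) (a : ι →₀ ℕ) : Submodule C S :=
  Submodule.span C (e '' {b | m.toSyn b < m.toSyn a})

/-- The ideal of the coefficients of `e a` in elements of `I` with leading monomial `e a`. -/
def MonomialOrder.leadingIdeal (m : MonomialOrder ι) (C : Type*) [CommRing C] [Algebra C S]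
    (e : (ι →₀ ℕ) → S) (I : Ideal S) (a : ι →₀ ℕ) : Ideal C :=
  ((I.restrictScalars C) ⊔ m.lower C e a).comap (LinearMap.toSpanSingleton C S (e a))

namespace MonomialOrder

variable (m : MonomialOrder ι) {e : (ι →₀ ℕ) → S}

theorem mem_leadingIdeal {I : Ideal S} {a : ι →₀ ℕ} {c : C} :
    c ∈ m.leadingIdeal C e I a ↔ ∃ f ∈ I, ∃ l ∈ m.lower C e a, f + l = c • e a := by
  simp [leadingIdeal, Submodule.mem_sup]

theorem leadingIdeal_mono {I J : Ideal S} (h : I ≤ J) (a : ι →₀ ℕ) :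
    m.leadingIdeal C e I a ≤ m.leadingIdeal C e J a := by
  intro c hc
  rw [mem_leadingIdeal] at hc ⊢
  obtain ⟨f, hf, l, hl, hfl⟩ := hc
  exact ⟨f, h hf, l, hl, hfl⟩

theorem mul_mem_lower (he : ∀ a b, ∃ u : Cˣ, e a * e b = (u : C) • e (a + b)) {a b : ι →₀ ℕ}
    {l : S} (hl : l ∈ m.lower C e a) : e b * l ∈ m.lower C e (b + a) := by
  induction hl using Submodule.span_induction with
  | mem x hx =>
    obtain ⟨c, hc, rfl⟩ := hx
    obtain ⟨u, hu⟩ := he b c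
    rw [hu]
    refine Submodule.smul_mem _ _ (Submodule.subset_span ⟨b + c, ?_, rfl⟩)
    change m.toSyn c < m.toSyn a at hc
    change m.toSyn (b + c) < m.toSyn (b + a)
    rw [map_add, map_add]
    gcongr
  | zero => simp
  | add x y _ _ hx hy =>
    rw [mul_add]
    exact add_mem hx hy
  | smul r x _ hx =>
    rw [mul_smul_comm]
    exact Submodule.smul_mem _ _ hx

/-- Left multiplication by `e b` shifts leading monomials by `b` and scales the leading coefficient
by a unit, which can be divided out. -/
theorem leadingIdeal_le_add (he : ∀ a b, ∃ u : Cˣ, e a * e b = (u : C) • e (a + b)) (I : Ideal S)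
    (a b : ι →₀ ℕ) : m.leadingIdeal C e I a ≤ m.leadingIdeal C e I (b + a) := by
  intro c hc
  rw [mem_leadingIdeal] at hc ⊢
  obtain ⟨f, hf, l, hl, hfl⟩ := hc
  obtain ⟨u, hu⟩ := he b a
  have hscale : (↑u⁻¹ : C) • (e b * (f + l)) = c • e (b + a) := by
    rw [hfl, mul_smul_comm, hu, smul_smul, smul_smul]
    congr 1
    rw [mul_right_comm, Units.inv_mul, one_mul]
  refine ⟨(↑u⁻¹ : C) • (e b * f), ?_, (↑u⁻¹ : C) • (e b * l), ?_, ?_⟩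
  · exact (I.restrictScalars C).smul_mem _ (I.mul_mem_left _ hf)
  · exact Submodule.smul_mem _ _ (m.mul_mem_lower he hl)
  · rw [← hscale, mul_add, smul_add]

/-- The ideal of the polynomial ring generated by the leading terms of the elements of `I`. -/
def initialIdeal (he : ∀ a b, ∃ u : Cˣ, e a * e b = (u : C) • e (a + b)) (I : Ideal S) :
    Ideal (MvPolynomial ι C) where
  carrier := {p | ∀ a, p.coeff a ∈ m.leadingIdeal C e I a}
  add_mem' hp hr a := by
    rw [MvPolynomial.coeff_add]
    exact add_mem (hp a) (hr a)
  zero_mem' a := by simp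
  smul_mem' r p hp a := by
    classical
    rw [smul_eq_mul, MvPolynomial.coeff_mul]
    refine sum_mem fun x hx => Ideal.mul_mem_left _ _ ?_
    rw [← Finset.HasAntidiagonal.mem_antidiagonal.1 hx]
    exact m.leadingIdeal_le_add he I x.2 x.1 (hp x.2)

/-- This provides a bound on the leading monomial without independence of `e`. The bound lies in `A`
itself, which makes the well-founded induction on leading monomials descend strictly. -/
theorem eq_zero_or_mem_span_le {A : Set (ι →₀ ℕ)} {s : S}
    (hs : s ∈ Submodule.span C (e '' A)) :
    s = 0 ∨ ∃ b ∈ A, s ∈ Submodule.span C (e '' {c | m.toSyn c ≤ m.toSyn b}) := by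
  have hmono {b b' : ι →₀ ℕ} (h : m.toSyn b ≤ m.toSyn b') :
      Submodule.span C (e '' {c | m.toSyn c ≤ m.toSyn b}) ≤
        Submodule.span C (e '' {c | m.toSyn c ≤ m.toSyn b'}) :=
    Submodule.span_mono (Set.image_mono fun c (hc : _ ≤ _) => hc.trans h)
  induction hs using Submodule.span_induction with
  | mem x hx =>
    obtain ⟨b, hb, rfl⟩ := hx
    exact .inr ⟨b, hb, Submodule.subset_span ⟨b, le_refl (m.toSyn b), rfl⟩⟩
  | zero => exact .inl rfl
  | add x y _ _ hx hy =>
    rcases hx with rfl | ⟨b, hb, hx⟩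
    · simpa using hy
    rcases hy with rfl | ⟨b', hb', hy⟩
    · exact .inr ⟨b, hb, by simpa using hx⟩
    rcases le_total (m.toSyn b) (m.toSyn b') with h | h
    · exact .inr ⟨b', hb', add_mem (hmono h hx) hy⟩
    · exact .inr ⟨b, hb, add_mem hx (hmono h hy)⟩
  | smul r x _ hx =>
    rcases hx with rfl | ⟨b, hb, hx⟩
    · simp
    · exact .inr ⟨b, hb, Submodule.smul_mem _ _ hx⟩

/-- Division with remainder: an element of `J` has the same leading term as some element of `I`. The
difference lies in `J` and has smaller leading monomial, so it is in `I` by induction. -/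
theorem le_of_leadingIdeal_le (hspan : Submodule.span C (Set.range e) = ⊤) {I J : Ideal S}
    (hIJ : I ≤ J) (h : ∀ a, m.leadingIdeal C e J a ≤ m.leadingIdeal C e I a) : J ≤ I := by
  have key : ∀ (t : m.syn) (a : ι →₀ ℕ), m.toSyn a = t → ∀ f ∈ J,
      f ∈ Submodule.span C (e '' {c | m.toSyn c ≤ m.toSyn a}) → f ∈ I := by
    intro t
    induction t using WellFoundedLT.induction with
    | ind t ih =>
      rintro a rfl f hfJ hf
      have hset : e '' {c | m.toSyn c ≤ m.toSyn a} =
          insert (e a) (e '' {c | m.toSyn c < m.toSyn a}) := by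
        rw [← Set.image_insert_eq]
        congr 1
        ext c
        change m.toSyn c ≤ m.toSyn a ↔ c = a ∨ m.toSyn c < m.toSyn a
        rw [le_iff_eq_or_lt, m.toSyn.injective.eq_iff]
      rw [hset, Submodule.mem_span_insert] at hf
      obtain ⟨c, l, hl, rfl⟩ := hf
      have hc : c ∈ m.leadingIdeal C e J a :=
        m.mem_leadingIdeal.2 ⟨_, hfJ, -l, neg_mem hl, by abel⟩
      obtain ⟨g, hg, l', hl', hgl⟩ := m.mem_leadingIdeal.1 (h a hc)
      have hsum : l' + l ∈ I := by
        have hJ : l' + l ∈ J := by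
          have := J.sub_mem hfJ (hIJ hg)
          rwa [← hgl, add_assoc, add_sub_cancel_left] at this
        rcases m.eq_zero_or_mem_span_le (add_mem hl' hl) with h0 | ⟨b, hb, hmem⟩
        · rw [h0]
          exact zero_mem _
        · exact ih _ hb b rfl _ hJ hmem
      rw [← hgl, add_assoc]
      exact add_mem hg hsum
  intro f hf
  have hf' : f ∈ Submodule.span C (e '' Set.univ) := by
    rw [Set.image_univ, hspan]
    trivial
  rcases m.eq_zero_or_mem_span_le hf' with rfl | ⟨b, -, hmem⟩
  · exact zero_mem _
  · exact key _ b rfl f hf hmem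

theorem initialIdeal_strictMono (he : ∀ a b, ∃ u : Cˣ, e a * e b = (u : C) • e (a + b))
    (hspan : Submodule.span C (Set.range e) = ⊤) : StrictMono (m.initialIdeal he) := by
  classical
  intro I J hIJ
  refine lt_of_le_not_ge (fun p hp a => m.leadingIdeal_mono hIJ.le a (hp a)) fun hle => ?_
  refine hIJ.not_ge (m.le_of_leadingIdeal_le hspan hIJ.le fun a c hc => ?_)
  -- A single monomial detects the leading coefficient `c` at `a`.
  have hmem : MvPolynomial.monomial a c ∈ m.initialIdeal he J := by
    intro b
    rw [MvPolynomial.coeff_monomial]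
    split_ifs with hab
    · exact hab ▸ hc
    · exact zero_mem _
  simpa using hle hmem a

end MonomialOrder

/-- Taking initial ideals embeds the left ideals of `S`, strictly monotonically, into the ideals of
a commutative polynomial ring, which is noetherian by Hilbert's basis theorem. -/
theorem isNoetherianRing_of_monomial_mul [Finite ι] [IsNoetherianRing C] {e : (ι →₀ ℕ) → S}
    (he : ∀ a b, ∃ u : Cˣ, e a * e b = (u : C) • e (a + b))
    (hspan : Submodule.span C (Set.range e) = ⊤) : IsNoetherianRing S := by
  obtain ⟨N, ⟨f⟩⟩ := Finite.exists_equiv_fin ι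
  -- Any linear order on the variables will do; it is needed only to form the lexicographic order.
  let : LinearOrder ι := LinearOrder.lift' f f.injective
  have : WellFoundedGT (Ideal S) :=
    (MonomialOrder.lex.initialIdeal_strictMono he hspan).wellFoundedGT
  exact isNoetherian_iff'.2 this

/-- The hypotheses are symmetric: in the opposite ring the product of the monomials `a` and `b` is
still a unit times the monomial `a + b`. -/
theorem isTwoSidedNoetherian_of_monomial_mul [Finite ι] [IsNoetherianRing C]
    {e : (ι →₀ ℕ) → S} (he : ∀ a b, ∃ u : Cˣ, e a * e b = (u : C) • e (a + b))
    (hspan : Submodule.span C (Set.range e) = ⊤) : IsTwoSidedNoetherian S := by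
  refine ⟨isNoetherianRing_of_monomial_mul he hspan,
    isNoetherianRing_of_monomial_mul (C := C) (e := fun a => MulOpposite.op (e a))
      (fun a b => ?_) ?_⟩
  · obtain ⟨u, hu⟩ := he b a
    exact ⟨u, by rw [← MulOpposite.op_mul, hu, add_comm, MulOpposite.op_smul]⟩
  · have : Set.range (fun a => MulOpposite.op (e a)) =
        (MulOpposite.opLinearEquiv C : S ≃ₗ[C] Sᵐᵒᵖ) '' Set.range e := by
      rw [← Set.range_comp]
      rfl
    rw [this]
    erw [← Submodule.map_span]
    rw [hspan, Submodule.map_top]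
    exact LinearEquiv.range _

end TwistedNoetherian

/-! ### Polynomial identities -/

section StandardIdentity

/-- Expanding the `m` arguments in `r < m` spanning vectors leaves only terms with a repeated
argument. -/
theorem AlternatingMap.eq_zero_of_span_eq_top {R M N : Type*} [CommRing R] [AddCommGroup M]
    [AddCommGroup N] [Module R M] [Module R N] {r m : ℕ} (hrm : r < m) {s : Fin r → M}
    (hs : Submodule.span R (Set.range s) = ⊤) (f : M [⋀^Fin m]→ₗ[R] N) : f = 0 := by
  ext v
  have hv : ∀ i, ∃ c : Fin r → R, ∑ j, c j • s j = v i := fun i =>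
    (Submodule.mem_span_range_iff_exists_fun R).1 (hs ▸ Submodule.mem_top)
  choose c hc using hv
  have hvc : v = fun i => ∑ j, c i j • s j := funext fun i => (hc i).symm
  rw [hvc, AlternatingMap.zero_apply, ← AlternatingMap.coe_multilinearMap,
    MultilinearMap.map_sum]
  refine Finset.sum_eq_zero fun t _ => ?_
  rw [MultilinearMap.map_smul_univ, AlternatingMap.coe_multilinearMap]
  obtain ⟨i, j, hij, ht⟩ := Fintype.exists_ne_map_eq_of_card_lt t (by simpa using hrm)
  rw [f.map_eq_zero_of_eq (fun i => s (t i)) (by simp only [ht]) hij, smul_zero]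

/-- The standard polynomial of degree `m`. -/
noncomputable def standardPolynomial (k : Type*) [CommRing k] (m : ℕ) : FreeAlgebra k ℕ :=
  ∑ σ : Equiv.Perm (Fin m),
    Equiv.Perm.sign σ • (List.ofFn fun i => FreeAlgebra.ι k (σ i : ℕ)).prod

theorem lift_standardPolynomial {k A : Type*} [CommRing k] [Ring A] [Algebra k A] (m : ℕ)
    (v : ℕ → A) : FreeAlgebra.lift k v (standardPolynomial k m) =
      ∑ σ : Equiv.Perm (Fin m), Equiv.Perm.sign σ • (List.ofFn fun i => v (σ i : ℕ)).prod := by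
  simp [standardPolynomial, map_sum, Units.smul_def, map_list_prod, List.map_ofFn,
    Function.comp_def]

/-- Evaluated at the letters of the free monoid algebra, the summands become distinct words, and the
word of the identity permutation has coefficient `1`. -/
theorem standardPolynomial_ne_zero (k : Type*) [CommRing k] [Nontrivial k] (m : ℕ) :
    standardPolynomial k m ≠ 0 := by
  intro h
  have h1 := lift_standardPolynomial (k := k) m
    (fun i => MonoidAlgebra.of k (FreeMonoid ℕ) (FreeMonoid.of i))
  rw [h, map_zero] at h1
  have h2 : ∀ σ : Equiv.Perm (Fin m),
      (List.ofFn fun i => MonoidAlgebra.of k (FreeMonoid ℕ) (FreeMonoid.of (σ i : ℕ))).prod =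
        MonoidAlgebra.single (FreeMonoid.ofList (List.ofFn fun i => (σ i : ℕ))) 1 := by
    intro σ
    have h3 : FreeMonoid.ofList (List.ofFn fun i => (σ i : ℕ)) =
        (List.ofFn fun i => FreeMonoid.of (σ i : ℕ)).prod := by
      have := FreeMonoid.lift_ofList FreeMonoid.of (List.ofFn fun i => (σ i : ℕ))
      rw [List.map_ofFn] at this
      refine Eq.trans ?_ this
      rw [show (FreeMonoid.of : ℕ → FreeMonoid ℕ) = MonoidHom.id _ ∘ FreeMonoid.of from rfl,
        FreeMonoid.lift_restrict]
      rfl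
    rw [h3, ← MonoidAlgebra.of_apply, map_list_prod, List.map_ofFn]
    rfl
  simp only [h2] at h1
  have h4 := congrArg (fun x => x.coeff (FreeMonoid.ofList (List.ofFn fun i : Fin m => (i : ℕ)))) h1
  have h5 : ∀ σ : Equiv.Perm (Fin m),
      (Equiv.Perm.sign σ • MonoidAlgebra.single
        (FreeMonoid.ofList (List.ofFn fun i => (σ i : ℕ))) (1 : k)).coeff
          (FreeMonoid.ofList (List.ofFn fun i : Fin m => (i : ℕ))) = if σ = 1 then 1 else 0 := by
    intro σ
    split_ifs with hσ
    · subst hσ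
      simp
    · have : FreeMonoid.ofList (List.ofFn fun i => (σ i : ℕ)) ≠
          FreeMonoid.ofList (List.ofFn fun i : Fin m => (i : ℕ)) := by
        intro heq
        apply hσ
        ext i
        exact congrFun (List.ofFn_injective (FreeMonoid.ofList.injective heq)) i
      simp [Units.smul_def, this]
  simp only [MonoidAlgebra.coeff_sum, Finsupp.finsetSum_apply, h5] at h4
  simp at h4

/-- The standard polynomial evaluates to the alternatization of the product map. This is multilinear
over the ring `R` acting centrally, so it vanishes once its degree exceeds the number of
`R`-generators. The rings `k` and `R` need not be related. -/
theorem isPIAlgebra_of_moduleFinite {k R A : Type*} [CommRing k] [Nontrivial k] [CommRing R]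
    [Ring A] [Algebra k A] [Algebra R A] [Module.Finite R A] : IsPIAlgebra k A := by
  obtain ⟨r, s, hs⟩ := Module.Finite.exists_fin (R := R) (M := A)
  refine ⟨standardPolynomial k (r + 1), standardPolynomial_ne_zero k _, fun v => ?_⟩
  have h := AlternatingMap.eq_zero_of_span_eq_top r.lt_succ_self hs
    (MultilinearMap.alternatization (MultilinearMap.mkPiAlgebraFin R (r + 1) A))
  have h' := DFunLike.congr_fun h fun i : Fin (r + 1) => v i
  rw [MultilinearMap.alternatization_apply] at h'
  rw [lift_standardPolynomial]
  simpa using h'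

end StandardIdentity

/-! ### Algebras that are finite over central powers of generators -/

section CentralPowers

theorem mul_pow_of_qCommute {T S : Type*} [CommRing T] [Ring S] [Algebra T S] {a b : S} {u : T}
    (h : a * b = u • (b * a)) (m : ℕ) : a * b ^ m = u ^ m • (b ^ m * a) := by
  induction m with
  | zero => simp
  | succ m ih =>
    rw [pow_succ, ← mul_assoc, ih, smul_mul_assoc, mul_assoc, h, mul_smul_comm, smul_smul,
      ← mul_assoc, ← pow_succ, ← pow_succ]

/-- This is the `q`-Leibniz rule. The correction carries a `q`-integer, so it disappears for
suitable `m`. At `m = 0` the truncated exponent `m - 1` is harmless, because the sum is empty. -/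
theorem mul_pow_of_qWeyl {T S : Type*} [CommRing T] [Ring S] [Algebra T S] {a b z : S} {u : T}
    (h : a * b = z + u • (b * a)) (hz : Commute z b) (m : ℕ) :
    a * b ^ m = u ^ m • (b ^ m * a) + (∑ i ∈ Finset.range m, u ^ i) • (b ^ (m - 1) * z) := by
  induction m with
  | zero => simp
  | succ m ih =>
    have h1 : (∑ i ∈ Finset.range m, u ^ i) • (b ^ (m - 1) * z) * b =
        (∑ i ∈ Finset.range m, u ^ i) • (b ^ m * z) := by
      cases m with
      | zero => simp
      | succ m =>
        rw [smul_mul_assoc, mul_assoc, hz.eq, ← mul_assoc, Nat.add_sub_cancel, pow_succ]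
    rw [pow_succ, ← mul_assoc, ih, add_mul, h1, smul_mul_assoc, mul_assoc, h, mul_add,
      mul_smul_comm, Finset.sum_range_succ, ← mul_assoc, ← pow_succ, Nat.add_sub_cancel, add_smul,
      smul_add, smul_smul, ← pow_succ]
    abel

variable {ι k S : Type*} [CommRing k] [Ring S] [Algebra k S]

theorem exists_orderedMonomial_eq_smul_of_pow_eq_algebraMap {R : Type*} [CommRing R] [Algebra R S] {g : ι → S}
    {N : ℕ} (r : ι → R) (hr : ∀ c, algebraMap R S (r c) = g c ^ N) (L : List ι)
    (a : ι →₀ ℕ) :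
    ∃ t : R, orderedMonomial L g a =
      t • (L.map fun c => g c ^ (a c % N)).prod := by
  induction L with
  | nil => exact ⟨1, by simp [orderedMonomial]⟩
  | cons c L ih =>
    obtain ⟨t, ht⟩ := ih
    refine ⟨r c ^ (a c / N) * t, ?_⟩
    simp only [orderedMonomial] at ht
    have hc : g c ^ a c = (r c ^ (a c / N)) • g c ^ (a c % N) := by
      rw [Algebra.smul_def, map_pow, hr, ← pow_mul, ← pow_add, Nat.div_add_mod]
    simp only [orderedMonomial, List.map_cons, List.prod_cons]
    rw [ht, hc, smul_mul_assoc, mul_smul_comm, smul_smul]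

/-- Letting the variables act as the central elements `g c ^ N` makes `S` a module over a polynomial
ring. Division of exponents by `N` shows that it is generated by the finitely many ordered monomials
with exponents less than `N`. -/
theorem isTwoSidedNoetherian_and_isPIAlgebra_of_central_pow [Nontrivial k] [IsNoetherianRing k]
    [Finite ι] {g : ι → S} {N : ℕ}
    (hN : 0 < N) (hcentral : ∀ c, g c ^ N ∈ Subalgebra.center k S) {L : List ι}
    (hspan : Submodule.span k (Set.range (orderedMonomial L g)) = ⊤) :
    IsTwoSidedNoetherian S ∧ IsPIAlgebra k S := by
  let φ : MvPolynomial ι k →ₐ[k] S :=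
    (Subalgebra.center k S).val.comp (MvPolynomial.aeval fun c => ⟨g c ^ N, hcentral c⟩)
  have hφ (r : MvPolynomial ι k) (s : S) : φ r * s = s * φ r :=
    (Subalgebra.mem_center_iff.1 (MvPolynomial.aeval
      (fun c => (⟨g c ^ N, hcentral c⟩ : Subalgebra.center k S)) r).2 s).symm
  let : Algebra (MvPolynomial ι k) S := φ.toRingHom.toAlgebra' hφ
  have hsmul (r : MvPolynomial ι k) (s : S) : r • s = φ r * s := rfl
  have hC (t : k) (s : S) : (MvPolynomial.C t : MvPolynomial ι k) • s = t • s := by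
    rw [hsmul, ← MvPolynomial.algebraMap_eq, φ.commutes, Algebra.smul_def]
  have hfin : Module.Finite (MvPolynomial ι k) S := by
    refine ⟨Submodule.fg_def.2 ⟨Set.range fun b : ι → Fin N =>
      (L.map fun c => g c ^ (b c : ℕ)).prod, Set.finite_range _, ?_⟩⟩
    rw [eq_top_iff]
    rintro s -
    have hs : s ∈ Submodule.span k (Set.range (orderedMonomial L g)) := hspan ▸ Submodule.mem_top
    induction hs using Submodule.span_induction with
    | mem x hx =>
      obtain ⟨a, rfl⟩ := hx
      obtain ⟨t, ht⟩ := exists_orderedMonomial_eq_smul_of_pow_eq_algebraMap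
        (R := MvPolynomial ι k) (g := g) (N := N) MvPolynomial.X (fun c => by
          change φ _ = _
          simp [φ]) L a
      rw [ht]
      exact Submodule.smul_mem _ _ (Submodule.subset_span
        ⟨fun c => ⟨a c % N, Nat.mod_lt _ hN⟩, rfl⟩)
    | zero => exact zero_mem _
    | add x y _ _ hx hy => exact add_mem hx hy
    | smul r x _ hx =>
      rw [← hC]
      exact Submodule.smul_mem _ _ hx
  have hfin' : Module.Finite (MvPolynomial ι k) Sᵐᵒᵖ :=
    Module.Finite.equiv (MulOpposite.opLinearEquiv (MvPolynomial ι k))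
  exact ⟨⟨IsNoetherianRing.of_finite (MvPolynomial ι k) S,
    IsNoetherianRing.of_finite (MvPolynomial ι k) Sᵐᵒᵖ⟩,
    isPIAlgebra_of_moduleFinite (R := MvPolynomial ι k)⟩

end CentralPowers

/-! ### Families of elements that satisfy the relations of a quantized Weyl algebra -/

namespace QuantizedWeyl

variable {T S : Type*} [CommRing T] [Ring S] [Algebra T S] {n : ℕ}

/-- The relations of the quantized Weyl algebra, for a family of elements of a `T`-algebra. -/
structure Satisfies (q : Fin n → Fin n → Tˣ) (γ : Fin n → Tˣ) (g : Fin n ⊕ Fin n → S) :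
    Prop where
  yy (i j : Fin n) : g (.inr i) * g (.inr j) = (q i j : T) • (g (.inr j) * g (.inr i))
  xx (i j : Fin n) (h : i < j) :
    g (.inl i) * g (.inl j) = (γ i * q i j : T) • (g (.inl j) * g (.inl i))
  xy_lt (i j : Fin n) (h : i < j) :
    g (.inl i) * g (.inr j) = (q j i : T) • (g (.inr j) * g (.inl i))
  xy_gt (i j : Fin n) (h : j < i) :
    g (.inl i) * g (.inr j) = (γ j * q j i : T) • (g (.inr j) * g (.inl i))
  xy_eq (j : Fin n) : g (.inl j) * g (.inr j) =
    1 + (γ j : T) • (g (.inr j) * g (.inl j)) +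
      ∑ l ∈ Finset.univ.filter (· < j), ((γ l : T) - 1) • (g (.inr l) * g (.inl l))

theorem satisfies_gen (q : Fin n → Fin n → Tˣ) (γ : Fin n → Tˣ) : Satisfies q γ (gen q γ) where
  yy i j := by
    simpa [gen, freeX, freeY] using RingQuot.mkAlgHom_rel T (Rel.yy (q := q) (γ := γ) i j)
  xx i j h := by
    simpa [gen, freeX, freeY] using RingQuot.mkAlgHom_rel T (Rel.xx (q := q) (γ := γ) i j h)
  xy_lt i j h := by
    simpa [gen, freeX, freeY] using RingQuot.mkAlgHom_rel T (Rel.xy_lt (q := q) (γ := γ) i j h)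
  xy_gt i j h := by
    simpa [gen, freeX, freeY] using RingQuot.mkAlgHom_rel T (Rel.xy_gt (q := q) (γ := γ) i j h)
  xy_eq j := by
    simpa [gen, freeX, freeY] using RingQuot.mkAlgHom_rel T (Rel.xy_eq (q := q) (γ := γ) j)

/-- The parameters of the quantum affine space associated with a quantized Weyl algebra. -/
def commParam (q : Fin n → Fin n → Tˣ) (γ : Fin n → Tˣ) :
    Fin n ⊕ Fin n → Fin n ⊕ Fin n → Tˣ
  | .inr i, .inr j => q i j
  | .inl i, .inl j => (if i < j then γ i else if j < i then (γ j)⁻¹ else 1) * q i j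
  -- The case `i = j` falls under the second branch and, when `q i i = 1`, gives `γ i`, the
  -- coefficient of the leading term of the relation between `x_i` and `y_i`.
  | .inl i, .inr j => (if i < j then 1 else γ j) * q j i
  | .inr j, .inl i => ((if i < j then 1 else γ j) * q j i)⁻¹

/-- The index of a generator. -/
def index (c : Fin n ⊕ Fin n) : Fin n := Sum.elim id id c

theorem deg_eq (c : Fin n ⊕ Fin n) : deg c = index c + 1 := by
  cases c <;> rfl

variable {q : Fin n → Fin n → Tˣ} {γ : Fin n → Tˣ}

theorem isMultiplicativelyAntisymmetric_commParam (hq : ∀ i, q i i = 1)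
    (hqq : ∀ i j, q i j * q j i = 1) : IsMultiplicativelyAntisymmetric (commParam q γ) := by
  refine ⟨?_, ?_⟩
  · rintro (i | i) <;> simp [commParam, hq]
  · rintro (i | i) (j | j)
    · rcases lt_trichotomy i j with h | rfl | h
      · simp only [commParam, h, h.not_gt, if_true, if_false]
        rw [mul_mul_mul_comm, hqq, mul_inv_cancel, one_mul]
      · simp [commParam, hq]
      · simp only [commParam, h, h.not_gt, if_true, if_false]
        rw [mul_mul_mul_comm, hqq, inv_mul_cancel, one_mul]
    · exact mul_inv_cancel _
    · exact inv_mul_cancel _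
    · exact hqq i j

namespace Satisfies

variable {g : Fin n ⊕ Fin n → S} (h : Satisfies q γ g)

theorem eq_smul_swap {a b : S} {u v : Tˣ} (h : a * b = (u : T) • (b * a)) (huv : u * v = 1) :
    b * a = (v : T) • (a * b) := by
  rw [h, smul_smul, ← Units.val_mul, mul_comm v, huv, Units.val_one, one_smul]

include h

theorem mul_eq_of_index_ne (hqq : ∀ i j, q i j * q j i = 1) {c c' : Fin n ⊕ Fin n}
    (hc : index c ≠ index c') : g c * g c' = (commParam q γ c c' : T) • (g c' * g c) := by
  have hxy : ∀ i j : Fin n, i ≠ j → g (.inl i) * g (.inr j) =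
      (commParam q γ (.inl i) (.inr j) : T) • (g (.inr j) * g (.inl i)) := by
    intro i j hij
    rcases hij.lt_or_gt with hlt | hlt
    · simpa [commParam, hlt] using h.xy_lt i j hlt
    · simpa [commParam, hlt.not_gt] using h.xy_gt i j hlt
  rcases c with i | i <;> rcases c' with j | j
  · rcases lt_or_gt_of_ne (show i ≠ j from hc) with hlt | hlt
    · simpa [commParam, hlt] using h.xx i j hlt
    · refine eq_smul_swap (u := γ j * q j i) (by simpa using h.xx j i hlt) ?_
      simp only [commParam, hlt, hlt.not_gt, if_true, if_false]
      rw [mul_mul_mul_comm, hqq, mul_inv_cancel, one_mul]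
  · exact hxy i j hc
  · exact eq_smul_swap (hxy j i (Ne.symm hc)) (by simp [commParam])
  · exact h.yy i j

omit h in
/-- The lower order term in the commutation rule of `x_j` and `y_j`. -/
def _root_.QuantizedWeyl.lowerTerm (γ : Fin n → Tˣ) (g : Fin n ⊕ Fin n → S) (j : Fin n) : S :=
  1 + ∑ l ∈ Finset.univ.filter (· < j), ((γ l : T) - 1) • (g (.inr l) * g (.inl l))

theorem x_mul_y (j : Fin n) : g (.inl j) * g (.inr j) =
    lowerTerm γ g j + (γ j : T) • (g (.inr j) * g (.inl j)) := by
  rw [h.xy_eq, lowerTerm]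
  abel

theorem y_mul_x (j : Fin n) : g (.inr j) * g (.inl j) =
    -((↑(γ j)⁻¹ : T) • lowerTerm γ g j) + (↑(γ j)⁻¹ : T) • (g (.inl j) * g (.inr j)) := by
  rw [h.x_mul_y, smul_add, smul_smul, Units.inv_mul, one_smul]
  abel

/-- For `l < j`, moving `x_j` or `y_j` past `y_l` and past `x_l` produces mutually inverse scalars,
so both commute with `y_l x_l`. -/
theorem lowerTerm_commute (hqq : ∀ i j, q i j * q j i = 1) (c : Fin n ⊕ Fin n) :
    Commute (lowerTerm γ g (index c)) (g c) := by
  refine (Commute.one_left _).add_left (Commute.sum_left _ _ _ fun l hl => ?_)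
  refine Commute.smul_left ?_ _
  have hl' : l < index c := (Finset.mem_filter.1 hl).2
  have h1 := h.mul_eq_of_index_ne hqq (c := c) (c' := .inr l) hl'.ne'
  have h2 := h.mul_eq_of_index_ne hqq (c := c) (c' := .inl l) hl'.ne'
  have h3 : commParam q γ c (.inr l) * commParam q γ c (.inl l) = 1 := by
    rcases c with j | j
    · have hl' : l < j := hl'
      simp only [commParam, hl', hl'.not_gt, if_true, if_false]
      rw [mul_mul_mul_comm, hqq, mul_inv_cancel, one_mul]
    · have hl' : l < j := hl'
      simp [commParam, hl']
  refine Commute.symm ?_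
  rw [commute_iff_eq, ← mul_assoc, h1, smul_mul_assoc, mul_assoc, h2, mul_smul_comm, smul_smul,
    ← Units.val_mul, h3, Units.val_one, one_smul, mul_assoc]

theorem sub_mem_below (hq : ∀ i, q i i = 1) (hqq : ∀ i j, q i j * q j i = 1)
    (F : AlgFiltration T S) (hF : ∀ c, g c ∈ F.obj (deg c)) (c c' : Fin n ⊕ Fin n) :
    g c * g c' - (commParam q γ c c' : T) • (g c' * g c) ∈ F.below (deg c + deg c') := by
  -- The choice of degrees matters here: `y_l x_l` has degree `2(l + 1)`, less than `2(j + 1)` for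
  -- `l < j`. With equal degrees it would not be of lower order.
  have hz : ∀ j : Fin n, lowerTerm γ g j ∈ F.below (j + 1 + (j + 1)) := by
    intro j
    refine add_mem (F.obj_le_below (by omega) F.one_mem) (sum_mem fun l hl => ?_)
    have hl' : l < j := (Finset.mem_filter.1 hl).2
    refine Submodule.smul_mem _ _ (F.obj_le_below ?_ (F.mul_mem (hF (.inr l)) (hF (.inl l))))
    simp only [deg_eq, index, Sum.elim_inl, Sum.elim_inr, id]
    omega
  by_cases hc : index c = index c'
  · rcases c with i | i <;> rcases c' with j | j <;> obtain rfl : i = j := hc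
    · simp [commParam, hq]
    · rw [h.x_mul_y]
      simpa [commParam, hq, deg_eq, index] using hz i
    · rw [h.y_mul_x]
      simpa [commParam, hq, deg_eq, index] using Submodule.smul_mem _ (↑(γ i)⁻¹ : T) (hz i)
    · simp [commParam, hq]
  · rw [h.mul_eq_of_index_ne hqq hc, sub_self]
    exact zero_mem _

/-- The `q`-Leibniz rule applies because the lower term commutes with `x_j` and `y_j`. The condition
`u ^ N = 1` trivialises the main coefficient and the vanishing `q`-integer kills the correction. The
parameter is `γ_j` for `x_j y_j` and its inverse for `y_j x_j`. -/
theorem commute_pow (hqq : ∀ i j, q i j * q j i = 1) {N : ℕ}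
    (hN : ∀ u : Tˣ, u ^ N = 1 ∧ ∑ i ∈ Finset.range N, (u : T) ^ i = 0) (c c' : Fin n ⊕ Fin n) :
    Commute (g c) (g c' ^ N) := by
  have hN' (u : Tˣ) : (u : T) ^ N = 1 := by rw [← Units.val_pow_eq_pow_val, (hN u).1, Units.val_one]
  by_cases hc : index c = index c'
  · rcases c with i | i <;> rcases c' with j | j <;> obtain rfl : i = j := hc
    · exact (Commute.refl _).pow_right N
    · have := mul_pow_of_qWeyl (h.x_mul_y i) (h.lowerTerm_commute hqq (.inr i)) N
      rwa [hN', (hN _).2, zero_smul, add_zero, one_smul] at this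
    · have := mul_pow_of_qWeyl (h.y_mul_x i)
        ((h.lowerTerm_commute hqq (.inl i)).smul_left _).neg_left N
      rwa [hN', (hN _).2, zero_smul, add_zero, one_smul] at this
    · exact (Commute.refl _).pow_right N
  · have := mul_pow_of_qCommute (h.mul_eq_of_index_ne hqq hc) N
    rwa [hN', one_smul] at this

theorem map {S' : Type*} [Ring S'] [Algebra T S'] (φ : S →ₐ[T] S') :
    Satisfies q γ fun c => φ (g c) where
  yy i j := by simpa using congrArg φ (h.yy i j)
  xx i j hij := by simpa using congrArg φ (h.xx i j hij)
  xy_lt i j hij := by simpa using congrArg φ (h.xy_lt i j hij)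
  xy_gt i j hij := by simpa using congrArg φ (h.xy_gt i j hij)
  xy_eq j := by simpa using congrArg φ (h.xy_eq j)

theorem extendScalars {C : Type*} [CommRing C] [Algebra T C] [Algebra C S] [IsScalarTower T C S] :
    Satisfies (fun i j => Units.map (algebraMap T C : T →* C) (q i j))
      (fun i => Units.map (algebraMap T C : T →* C) (γ i)) g where
  yy i j := by simpa using h.yy i j
  xx i j hij := by simpa [← map_mul] using h.xx i j hij
  xy_lt i j hij := by simpa using h.xy_lt i j hij
  xy_gt i j hij := by simpa [← map_mul] using h.xy_gt i j hij
  xy_eq j := by simpa [sub_smul] using h.xy_eq j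

theorem baseChange (C : Type*) [CommRing C] [Algebra T C] :
    Satisfies (fun i j => Units.map (algebraMap T C : T →* C) (q i j))
      (fun i => Units.map (algebraMap T C : T →* C) (γ i)) fun c => (1 : C) ⊗ₜ[T] g c :=
  (h.map (Algebra.TensorProduct.includeRight : S →ₐ[T] C ⊗[T] S)).extendScalars

/-- The map out of a quantized Weyl algebra given by elements that satisfy its relations. -/
noncomputable def lift : QuantizedWeyl q γ →ₐ[T] S :=
  RingQuot.liftAlgHom T ⟨FreeAlgebra.lift T g, by
    rintro _ _ (⟨i, j⟩ | ⟨i, j, hij⟩ | ⟨i, j, hij⟩ | ⟨i, j, hij⟩ | ⟨j⟩)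
    · simpa [freeX, freeY] using h.yy i j
    · simpa [freeX, freeY] using h.xx i j hij
    · simpa [freeX, freeY] using h.xy_lt i j hij
    · simpa [freeX, freeY] using h.xy_gt i j hij
    · simpa [freeX, freeY] using h.xy_eq j⟩

@[simp]
theorem lift_gen (c : Fin n ⊕ Fin n) : h.lift (gen q γ c) = g c := by
  simp [lift, gen]

end Satisfies

end QuantizedWeyl

namespace QuantizedWeyl

/-! ### The Fock representation -/

section Fock

variable {T : Type*} [CommRing T] {n : ℕ}

/-- `∏_{j < i} (u j) ^ (a j)`. -/
def weight (u : Fin n → T) (i : Fin n) (a : Fin n → ℕ) : T :=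
  ∏ j ∈ Finset.univ.filter (· < i), u j ^ a j

/-- The `q`-integer `1 + u + ⋯ + u ^ (m - 1)`. -/
def qInt (u : T) (m : ℕ) : T := ∑ s ∈ Finset.range m, u ^ s

theorem qInt_zero (u : T) : qInt u 0 = 0 := by simp [qInt]

theorem qInt_succ (u : T) (m : ℕ) : qInt u (m + 1) = 1 + u * qInt u m := by
  rw [qInt, Finset.sum_range_succ', qInt, Finset.mul_sum, pow_zero, add_comm]
  simp only [pow_succ']

/-- Replace the `i`-th exponent by its successor. -/
def raise (i : Fin n) (a : Fin n → ℕ) : Fin n → ℕ := Function.update a i (a i + 1)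

/-- Replace the `i`-th exponent by its predecessor. -/
def lower (i : Fin n) (a : Fin n → ℕ) : Fin n → ℕ := Function.update a i (a i - 1)

theorem raise_self (i : Fin n) (a : Fin n → ℕ) : raise i a i = a i + 1 := by simp [raise]

theorem raise_of_ne {i j : Fin n} (h : j ≠ i) (a : Fin n → ℕ) : raise i a j = a j := by
  simp [raise, h]

theorem lower_of_ne {i j : Fin n} (h : j ≠ i) (a : Fin n → ℕ) : lower i a j = a j := by
  simp [lower, h]

theorem raise_comm (i j : Fin n) (a : Fin n → ℕ) : raise i (raise j a) = raise j (raise i a) := by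
  rcases eq_or_ne i j with rfl | h
  · rfl
  · simp only [raise, Function.update_of_ne h, Function.update_of_ne h.symm]
    exact Function.update_comm h.symm _ _ _

theorem lower_comm (i j : Fin n) (a : Fin n → ℕ) : lower i (lower j a) = lower j (lower i a) := by
  rcases eq_or_ne i j with rfl | h
  · rfl
  · simp only [lower, Function.update_of_ne h, Function.update_of_ne h.symm]
    exact Function.update_comm h.symm _ _ _

theorem lower_raise_comm {i j : Fin n} (h : i ≠ j) (a : Fin n → ℕ) :
    lower i (raise j a) = raise j (lower i a) := by
  simp only [raise, lower, Function.update_of_ne h, Function.update_of_ne h.symm]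
  exact Function.update_comm h.symm _ _ _

theorem lower_raise (i : Fin n) (a : Fin n → ℕ) : lower i (raise i a) = a := by
  simp [raise, lower]

theorem raise_lower {i : Fin n} {a : Fin n → ℕ} (h : a i ≠ 0) : raise i (lower i a) = a := by
  simp [raise, lower, Nat.sub_add_cancel (Nat.one_le_iff_ne_zero.2 h)]

theorem weight_congr (u : Fin n → T) {i : Fin n} {a b : Fin n → ℕ} (h : ∀ j < i, a j = b j) :
    weight u i a = weight u i b :=
  Finset.prod_congr rfl fun j hj => by rw [h j (Finset.mem_filter.1 hj).2]

theorem weight_raise_of_le (u : Fin n → T) {i j : Fin n} (h : i ≤ j) (a : Fin n → ℕ) :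
    weight u i (raise j a) = weight u i a :=
  weight_congr u fun _ hl => raise_of_ne (hl.trans_le h).ne a

theorem weight_lower_of_le (u : Fin n → T) {i j : Fin n} (h : i ≤ j) (a : Fin n → ℕ) :
    weight u i (lower j a) = weight u i a :=
  weight_congr u fun _ hl => lower_of_ne (hl.trans_le h).ne a

theorem weight_raise_of_lt (u : Fin n → T) {i j : Fin n} (h : j < i) (a : Fin n → ℕ) :
    weight u i (raise j a) = u j * weight u i a := by
  have hj : j ∈ Finset.univ.filter (· < i) := by simpa using h
  rw [weight, weight, ← Finset.mul_prod_erase _ _ hj, ← Finset.mul_prod_erase _ _ hj, raise_self,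
    pow_succ', mul_assoc]
  congr 2
  exact Finset.prod_congr rfl fun l hl => by rw [raise_of_ne (Finset.ne_of_mem_erase hl)]

theorem weight_lower_of_lt (u : Fin n → T) {i j : Fin n} (h : j < i) {a : Fin n → ℕ}
    (ha : a j ≠ 0) : u j * weight u i (lower j a) = weight u i a := by
  rw [← weight_raise_of_lt u h, raise_lower ha]

theorem weight_mul (u v : Fin n → T) (i : Fin n) (a : Fin n → ℕ) :
    weight u i a * weight v i a = weight (fun j => u j * v j) i a := by
  simp only [weight, ← Finset.prod_mul_distrib, mul_pow]

/-- The sum telescopes, because `(u - 1)(1 + u + ⋯ + u^(m-1)) = u^m - 1`. For `u = γ` its terms are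
the eigenvalues of `(γ_l - 1) y_l x_l` on the Fock space. -/
theorem weight_sub_one (u : Fin n → T) (i : Fin n) (a : Fin n → ℕ) :
    weight u i a = 1 + ∑ l ∈ Finset.univ.filter (· < i),
      (u l - 1) * (qInt (u l) (a l) * weight u l a) := by
  have h : ∀ m (hm : m ≤ n), ∏ j ∈ Finset.univ.filter (fun j : Fin n => (j : ℕ) < m), u j ^ a j =
      1 + ∑ l ∈ Finset.univ.filter (fun j : Fin n => (j : ℕ) < m),
        (u l - 1) * (qInt (u l) (a l) * weight u l a) := by
    intro m hm
    induction m with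
    | zero => simp
    | succ m ih =>
      have hset : Finset.univ.filter (fun j : Fin n => (j : ℕ) < m + 1) =
          insert ⟨m, hm⟩ (Finset.univ.filter (fun j : Fin n => (j : ℕ) < m)) := by
        ext j
        simp [Fin.ext_iff]
        omega
      have hnot : (⟨m, hm⟩ : Fin n) ∉ Finset.univ.filter (fun j : Fin n => (j : ℕ) < m) := by
        simp
      have hw : weight u ⟨m, hm⟩ a =
          ∏ j ∈ Finset.univ.filter (fun j : Fin n => (j : ℕ) < m), u j ^ a j := rfl
      rw [hset, Finset.prod_insert hnot, Finset.sum_insert hnot, hw, add_left_comm,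
        ← ih (by omega), qInt, ← mul_assoc, mul_geom_sum]
      ring
  exact h i i.2.le

/-- The operators of the Fock representation, on the free module with basis the monomials
`t ^ a`: the generator `y_i` raises the exponent of `t_i` and `x_i` lowers it. -/
noncomputable def fock (q : Fin n → Fin n → Tˣ) (γ : Fin n → Tˣ) :
    Fin n ⊕ Fin n → Module.End T ((Fin n → ℕ) →₀ T)
  | .inl i => Finsupp.lsum T fun a => LinearMap.toSpanSingleton T _
      -- If `a i = 0`, the exponent is truncated at `0`, but the `q`-integer in the coefficient
      -- vanishes.
      (Finsupp.single (lower i a)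
        (qInt (γ i : T) (a i) * weight (fun j => (γ j * q j i : T)) i a))
  | .inr i => Finsupp.lsum T fun a => LinearMap.toSpanSingleton T _
      (Finsupp.single (raise i a) (weight (fun j => (q i j : T)) i a))

variable (q : Fin n → Fin n → Tˣ) (γ : Fin n → Tˣ)

theorem fock_inl_single (i : Fin n) (a : Fin n → ℕ) (t : T) :
    fock q γ (.inl i) (Finsupp.single a t) = Finsupp.single (lower i a)
      (t * (qInt (γ i : T) (a i) * weight (fun j => (γ j * q j i : T)) i a)) := by
  simp [fock, -Finsupp.single_mul]

theorem fock_inr_single (i : Fin n) (a : Fin n → ℕ) (t : T) :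
    fock q γ (.inr i) (Finsupp.single a t) =
      Finsupp.single (raise i a) (t * weight (fun j => (q i j : T)) i a) := by
  simp [fock]

variable {q γ}

/-- The formulas are forced by letting the `x_i` annihilate the vacuum `t^0` and letting `t^a` be
the ordered monomial `y^a` applied to it. The operators `y_l x_l` and `x_j y_j` are then diagonal,
and the inhomogeneous relation becomes the scalar identity `[a_j + 1] w = 1 + γ_j [a_j] w + (w - 1)`
with `w = ∏_{i<j} γ_i^{a_i}`. -/
theorem satisfies_fock (hq : ∀ i, q i i = 1) (hqq : ∀ i j, q i j * q j i = 1) :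
    Satisfies q γ (fock q γ) := by
  have hqv : ∀ i j, (q i j : T) * q j i = 1 := fun i j => by
    rw [← Units.val_mul, hqq, Units.val_one]
  have yy : ∀ i j : Fin n, i < j → fock q γ (.inr i) * fock q γ (.inr j) =
      (q i j : T) • (fock q γ (.inr j) * fock q γ (.inr i)) := by
    intro i j hij
    refine Finsupp.lhom_ext fun a t => ?_
    simp only [Module.End.mul_apply, LinearMap.smul_apply, fock_inr_single, Finsupp.smul_single,
      smul_eq_mul]
    rw [raise_comm, weight_raise_of_le _ hij.le, weight_raise_of_lt _ hij]
    congr 1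
    linear_combination (-t * weight (fun l => (q i l : T)) i a *
      weight (fun l => (q j l : T)) j a) * hqv i j
  refine ⟨?_, ?_, ?_, ?_, ?_⟩
  · intro i j
    rcases lt_trichotomy i j with h | rfl | h
    · exact yy i j h
    · simp [hq]
    · exact Satisfies.eq_smul_swap (yy j i h) (hqq j i)
  · intro i j hij
    refine Finsupp.lhom_ext fun a t => ?_
    simp only [Module.End.mul_apply, LinearMap.smul_apply, fock_inl_single, Finsupp.smul_single,
      smul_eq_mul]
    rw [lower_comm, weight_lower_of_le _ hij.le, lower_of_ne hij.ne, lower_of_ne hij.ne']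
    congr 1
    -- At `a i = 0` both sides vanish; otherwise the exponent can really be lowered and the weights
    -- compared.
    rcases eq_or_ne (a i) 0 with h0 | h0
    · simp [h0, qInt_zero]
    rw [← weight_lower_of_lt (fun l => (γ l * q l j : T)) hij h0]
    ring
  · intro i j hij
    refine Finsupp.lhom_ext fun a t => ?_
    simp only [Module.End.mul_apply, LinearMap.smul_apply, fock_inl_single, fock_inr_single,
      Finsupp.smul_single, smul_eq_mul]
    rw [lower_raise_comm hij.ne, weight_raise_of_le _ hij.le, raise_of_ne hij.ne]
    congr 1
    rcases eq_or_ne (a i) 0 with h0 | h0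
    · simp [h0, qInt_zero]
    rw [← weight_lower_of_lt (fun l => (q j l : T)) hij h0]
    ring
  · intro i j hij
    refine Finsupp.lhom_ext fun a t => ?_
    simp only [Module.End.mul_apply, LinearMap.smul_apply, fock_inl_single, fock_inr_single,
      Finsupp.smul_single, smul_eq_mul]
    rw [lower_raise_comm hij.ne', weight_raise_of_lt _ hij, weight_lower_of_le _ hij.le,
      raise_of_ne hij.ne']
    congr 1
    ring
  · intro j
    refine Finsupp.lhom_ext fun a t => ?_
    have hyx : ∀ l, fock q γ (.inr l) (fock q γ (.inl l) (Finsupp.single a t)) =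
        Finsupp.single a (t * (qInt (γ l : T) (a l) * weight (fun i => (γ i : T)) l a)) := by
      intro l
      rw [fock_inl_single, fock_inr_single, weight_lower_of_le _ le_rfl]
      rcases eq_or_ne (a l) 0 with h0 | h0
      · simp [h0, qInt_zero]
      rw [raise_lower h0]
      congr 1
      have : weight (fun i => (γ i : T)) l a = weight (fun i => (γ i * q i l : T)) l a *
          weight (fun i => (q l i : T)) l a := by
        rw [weight_mul]
        congr 1
        funext i
        rw [mul_assoc, hqv, mul_one]
      rw [this]
      ring
    have hxy : fock q γ (.inl j) (fock q γ (.inr j) (Finsupp.single a t)) =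
        Finsupp.single a (t * (qInt (γ j : T) (a j + 1) * weight (fun i => (γ i : T)) j a)) := by
      rw [fock_inr_single, fock_inl_single, weight_raise_of_le _ le_rfl, lower_raise, raise_self]
      congr 1
      have : weight (fun i => (γ i : T)) j a = weight (fun i => (γ i * q i j : T)) j a *
          weight (fun i => (q j i : T)) j a := by
        rw [weight_mul]
        congr 1
        funext i
        rw [mul_assoc, hqv, mul_one]
      rw [this]
      ring
    simp only [Module.End.mul_apply, LinearMap.add_apply, LinearMap.smul_apply, LinearMap.sum_apply,
      Module.End.one_apply, hyx, hxy, Finsupp.smul_single, smul_eq_mul, ← Finsupp.single_add,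
      ← Finsupp.single_finsetSum]
    congr 1
    have hsum : ∑ l ∈ Finset.univ.filter (· < j), ((γ l : T) - 1) *
        (t * (qInt (γ l : T) (a l) * weight (fun i => (γ i : T)) l a)) =
        t * (weight (fun i => (γ i : T)) j a - 1) := by
      rw [weight_sub_one (fun i => (γ i : T)) j a, add_sub_cancel_left, Finset.mul_sum]
      exact Finset.sum_congr rfl fun l _ => by ring
    rw [hsum, qInt_succ]
    ring

/-! ### Linear independence of the ordered monomials -/

section Domain

variable [IsDomain T]

theorem weight_ne_zero {u : Fin n → T} (hu : ∀ j, u j ≠ 0) (i : Fin n) (a : Fin n → ℕ) :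
    weight u i a ≠ 0 :=
  Finset.prod_ne_zero_iff.2 fun j _ => pow_ne_zero _ (hu j)

/-- Each application of `x_i` contributes a unit weight and the `q`-integer of the current exponent,
which is nonzero exactly until the exponent reaches `0`. -/
theorem exists_fock_inl_pow_single (hγ : ∀ i m, m ≠ 0 → qInt (γ i : T) m ≠ 0) (i : Fin n) (m : ℕ)
    (b : Fin n → ℕ) : ∃ c : T, (∀ t, (fock q γ (.inl i) ^ m) (Finsupp.single b t) =
      Finsupp.single (Function.update b i (b i - m)) (t * c)) ∧ (c ≠ 0 ↔ m ≤ b i) := by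
  induction m with
  | zero => exact ⟨1, by simp, by simp⟩
  | succ m ih =>
    obtain ⟨c, hc, hc0⟩ := ih
    refine ⟨c * (qInt (γ i : T) (b i - m) *
      weight (fun j => (γ j * q j i : T)) i (Function.update b i (b i - m))), fun t => ?_, ?_⟩
    · rw [pow_succ', Module.End.mul_apply, hc, fock_inl_single, lower, Function.update_self,
        Function.update_idem, mul_assoc, Nat.sub_sub]
    · have hw := weight_ne_zero (u := fun j => (γ j * q j i : T))
        (fun j => (γ j * q j i).ne_zero) i (Function.update b i (b i - m))
      have hq0 : qInt (γ i : T) (b i - m) ≠ 0 ↔ b i - m ≠ 0 := by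
        refine ⟨fun h h0 => h (by rw [h0, qInt_zero]), hγ i _⟩
      rw [mul_ne_zero_iff, mul_ne_zero_iff, hc0, hq0]
      simp only [hw, ne_eq, not_false_eq_true, and_true]
      omega

theorem exists_fock_inr_pow_single (i : Fin n) (m : ℕ)
    (b : Fin n → ℕ) : ∃ c : T, (∀ t, (fock q γ (.inr i) ^ m) (Finsupp.single b t) =
      Finsupp.single (Function.update b i (b i + m)) (t * c)) ∧ c ≠ 0 := by
  induction m with
  | zero => exact ⟨1, by simp, by simp⟩
  | succ m ih =>
    obtain ⟨c, hc, hc0⟩ := ih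
    refine ⟨c * weight (fun j => (q i j : T)) i (Function.update b i (b i + m)), fun t => ?_, ?_⟩
    · rw [pow_succ', Module.End.mul_apply, hc, fock_inr_single, raise, Function.update_self,
        Function.update_idem, mul_assoc, add_assoc]
    · exact mul_ne_zero hc0 (weight_ne_zero (fun j => (q i j).ne_zero) _ _)

theorem exists_prod_fock_inl_single (hγ : ∀ i m, m ≠ 0 → qInt (γ i : T) m ≠ 0)
    {M : List (Fin n)} (hM : M.Nodup) (β b : Fin n → ℕ) :
    ∃ c : T, (∀ t, (M.map fun i => fock q γ (.inl i) ^ β i).prod (Finsupp.single b t) =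
      Finsupp.single (fun i => if i ∈ M then b i - β i else b i) (t * c)) ∧
      (c ≠ 0 ↔ ∀ i ∈ M, β i ≤ b i) := by
  induction M with
  | nil => exact ⟨1, by simp, by simp⟩
  | cons i M ih =>
    obtain ⟨hi, hM⟩ := List.nodup_cons.1 hM
    obtain ⟨c, hc, hc0⟩ := ih hM
    obtain ⟨c', hc', hc0'⟩ := exists_fock_inl_pow_single (q := q) hγ i (β i)
      (fun i => if i ∈ M then b i - β i else b i)
    refine ⟨c * c', fun t => ?_, ?_⟩
    · rw [List.map_cons, List.prod_cons, Module.End.mul_apply, hc, hc', mul_assoc]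
      congr 1
      funext j
      rcases eq_or_ne j i with rfl | hj
      · simp [hi]
      · simp [hj]
    · rw [mul_ne_zero_iff, hc0, hc0']
      simp [hi, and_comm]

theorem exists_prod_fock_inr_single {M : List (Fin n)} (hM : M.Nodup) (α b : Fin n → ℕ) :
    ∃ c : T, (∀ t, (M.map fun i => fock q γ (.inr i) ^ α i).prod (Finsupp.single b t) =
      Finsupp.single (fun i => if i ∈ M then b i + α i else b i) (t * c)) ∧ c ≠ 0 := by
  induction M with
  | nil => exact ⟨1, by simp, by simp⟩
  | cons i M ih =>
    obtain ⟨hi, hM⟩ := List.nodup_cons.1 hM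
    obtain ⟨c, hc, hc0⟩ := ih hM
    obtain ⟨c', hc', hc0'⟩ := exists_fock_inr_pow_single (q := q) (γ := γ) i (α i)
      (fun i => if i ∈ M then b i + α i else b i)
    refine ⟨c * c', fun t => ?_, mul_ne_zero hc0 hc0'⟩
    rw [List.map_cons, List.prod_cons, Module.End.mul_apply, hc, hc', mul_assoc]
    congr 1
    funext j
    rcases eq_or_ne j i with rfl | hj
    · simp [hi]
    · simp [hj]

end Domain

end Fock

/-- The generators, listed as `y_1, …, y_n, x_1, …, x_n`. -/
def generators (n : ℕ) : List (Fin n ⊕ Fin n) :=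
  (List.finRange n).map .inr ++ (List.finRange n).map .inl

theorem count_eq_one_of_nodup {α : Type*} [DecidableEq α] {l : List α} (h : l.Nodup) {a : α}
    (ha : a ∈ l) : l.count a = 1 :=
  List.count_eq_one_of_mem h ha

theorem count_generators {n : ℕ} (c : Fin n ⊕ Fin n) :
    @List.count _ instBEqOfDecidableEq c (generators n) = 1 := by
  refine count_eq_one_of_nodup ?_ (by cases c <;> simp [generators])
  refine List.Nodup.append ((List.nodup_finRange n).map Sum.inr_injective)
    ((List.nodup_finRange n).map Sum.inl_injective) ?_
  simp [List.Disjoint]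

/-! ### Independence of the ordered monomials, and its base change -/

section PBW

variable {T : Type*} [CommRing T] {n : ℕ} {q : Fin n → Fin n → Tˣ} {γ : Fin n → Tˣ}

theorem exists_orderedMonomial_fock_single [IsDomain T]
    (hγ : ∀ i m, m ≠ 0 → qInt (γ i : T) m ≠ 0) (a : Fin n ⊕ Fin n →₀ ℕ) (b : Fin n → ℕ) :
    ∃ c : T, orderedMonomial (generators n) (fock q γ) a (Finsupp.single b 1) =
      Finsupp.single (fun i => b i - a (.inl i) + a (.inr i)) c ∧
      (c ≠ 0 ↔ ∀ i, a (.inl i) ≤ b i) := by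
  obtain ⟨c, hc, hc0⟩ := exists_prod_fock_inl_single (q := q) hγ (List.nodup_finRange n)
    (fun i => a (.inl i)) b
  obtain ⟨c', hc', hc0'⟩ := exists_prod_fock_inr_single (q := q) (γ := γ) (List.nodup_finRange n)
    (fun i => a (.inr i)) (fun i => b i - a (.inl i))
  refine ⟨c * c', ?_, ?_⟩
  · simp only [List.mem_finRange, if_true] at hc hc'
    simp only [orderedMonomial, generators, List.map_append, List.map_map, List.prod_append,
      Function.comp_def, Module.End.mul_apply, hc, hc', one_mul]
  · rw [mul_ne_zero_iff, hc0]
    simp [hc0']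

/-- In a nontrivial relation, choose a monomial `y^α x^β` with `|β|` minimal and apply the relation
to `t^β`. A term `y^α' x^β'` survives only if `β' ≤ β`, hence `β' = β` by minimality, and it then
yields a multiple of `t^α'`. The coefficient of `t^α` isolates the chosen term. -/
theorem linearIndependent_orderedMonomial_fock [IsDomain T]
    (hγ : ∀ i m, m ≠ 0 → qInt (γ i : T) m ≠ 0) :
    LinearIndependent T (orderedMonomial (generators n) (fock q γ)) := by
  classical
  refine (linearIndependent_iff' (R := T) (M := Module.End T ((Fin n → ℕ) →₀ T))).2
    fun s r hr => ?_
  by_contra! hne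
  have hne' : (s.filter fun a => r a ≠ 0).Nonempty := by
    obtain ⟨a, ha, ha0⟩ := hne
    exact ⟨a, Finset.mem_filter.2 ⟨ha, ha0⟩⟩
  obtain ⟨a₀, ha₀, hmin⟩ := Finset.exists_min_image _ (fun a => ∑ i, a (.inl i)) hne'
  rw [Finset.mem_filter] at ha₀
  have h1 := congrArg (fun f : Module.End T ((Fin n → ℕ) →₀ T) =>
    f (Finsupp.single (fun i => a₀ (.inl i)) 1) fun i => a₀ (.inr i)) hr
  simp only [LinearMap.sum_apply, LinearMap.smul_apply, LinearMap.zero_apply, Finsupp.finsetSum_apply,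
    Finsupp.smul_apply, Finsupp.coe_zero, Pi.zero_apply] at h1
  rw [Finset.sum_eq_single a₀] at h1
  · obtain ⟨c, hc, hc0⟩ := exists_orderedMonomial_fock_single (q := q) hγ a₀
      (fun i => a₀ (.inl i))
    rw [hc] at h1
    simp only [tsub_self, zero_add, Finsupp.single_eq_same, smul_eq_mul, mul_eq_zero] at h1
    exact h1.elim ha₀.2 (hc0.2 fun _ => le_rfl)
  · intro a has haa
    rcases eq_or_ne (r a) 0 with h0 | h0
    · rw [h0, zero_smul]
    obtain ⟨c, hc, hc0⟩ := exists_orderedMonomial_fock_single (q := q) hγ a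
      (fun i => a₀ (.inl i))
    rw [hc]
    rcases eq_or_ne c 0 with hcz | hcz
    · simp [hcz]
    have hle := hc0.1 hcz
    have hsum := hmin a (Finset.mem_filter.2 ⟨has, h0⟩)
    have heq : ∀ i, a (.inl i) = a₀ (.inl i) := fun i =>
      (Finset.sum_eq_sum_iff_of_le fun i _ => hle i).1
        (le_antisymm (Finset.sum_le_sum fun i _ => hle i) hsum) i (Finset.mem_univ i)
    rw [Finsupp.single_eq_of_ne, smul_zero]
    intro h
    apply haa
    ext (i | i)
    · exact heq i
    · have := congrFun h i
      simpa [heq] using this.symm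
  · exact fun h => absurd ha₀.1 h

theorem filtration_obj_eq_span (hq : ∀ i, q i i = 1) (hqq : ∀ i j, q i j * q j i = 1) (m : ℕ) :
    (filtration q γ).obj m = Submodule.span T (orderedMonomial (generators n) (gen q γ) ''
      {a | wordDegree (generators n) deg a ≤ m}) :=
  AlgFiltration.ofDegrees_obj_eq_span (adjoin_gen q γ) (fun c c' => ⟨commParam q γ c c',
    (satisfies_gen q γ).sub_mem_below hq hqq _ (gen_mem q γ) c c'⟩) count_generators m

/-- Over `T` the monomials form a basis. The base change of that algebra satisfies the relations
over `K`, and the map into it from the algebra over `K` sends the monomials to the base-changed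
basis. The map from `T` to `K` may have a kernel, which permits specialisation. -/
theorem linearIndependent_gen_map {K : Type*} [CommRing K] [Algebra T K]
    (hq : ∀ i, q i i = 1) (hqq : ∀ i j, q i j * q j i = 1)
    (hli : LinearIndependent T (orderedMonomial (generators n) (gen q γ))) :
    LinearIndependent K (orderedMonomial (generators n)
      (gen (fun i j => Units.map (algebraMap T K : T →* K) (q i j))
        (fun i => Units.map (algebraMap T K : T →* K) (γ i)))) := by
  let b : Module.Basis _ T (QuantizedWeyl q γ) :=
    .mk hli ((filtration q γ).span_range_eq_top (filtration_obj_eq_span hq hqq)).ge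
  have hsat := (satisfies_gen q γ).baseChange K
  refine LinearIndependent.of_comp hsat.lift.toLinearMap ?_
  suffices heq : hsat.lift.toLinearMap ∘ orderedMonomial (generators n) (gen _ _) =
      b.baseChange K by
    rw [heq]
    exact (b.baseChange K).linearIndependent
  funext a
  have : (1 : K) ⊗ₜ[T] orderedMonomial (generators n) (gen q γ) a =
      orderedMonomial (generators n) (fun c => (1 : K) ⊗ₜ[T] gen q γ c) a :=
    map_orderedMonomial (Algebra.TensorProduct.includeRight : _ →ₐ[T] K ⊗[T] QuantizedWeyl q γ)
      _ _ _
  simp [map_orderedMonomial, b, this]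

theorem linearIndependent_gen_of_qInt_ne_zero [IsDomain T]
    (hq : ∀ i, q i i = 1) (hqq : ∀ i j, q i j * q j i = 1)
    (hγ : ∀ i m, m ≠ 0 → qInt (γ i : T) m ≠ 0) :
    LinearIndependent T (orderedMonomial (generators n) (gen q γ)) := by
  refine LinearIndependent.of_comp (satisfies_fock (γ := γ) hq hqq).lift.toLinearMap ?_
  suffices heq : (satisfies_fock (γ := γ) hq hqq).lift.toLinearMap ∘
      orderedMonomial (generators n) (gen q γ) = orderedMonomial (generators n) (fock q γ) by
    rw [heq]
    exact linearIndependent_orderedMonomial_fock hγ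
  funext a
  simp [map_orderedMonomial]

end PBW

/-! ### Removal of the condition on the `γ_i` by deformation -/

section Field

variable {k : Type*} [Field k] {n : ℕ} {q : Fin n → Fin n → kˣ} {γ : Fin n → kˣ}

open PowerSeries in
-- Otherwise `(u + X)^m = 1`, which is impossible for a polynomial of degree `m > 0`.
theorem qInt_C_add_X_ne_zero (u : k) {m : ℕ} (hm : m ≠ 0) :
    qInt (PowerSeries.C u + X : k⟦X⟧) m ≠ 0 := by
  intro h
  have h1 := mul_geom_sum (PowerSeries.C u + X : k⟦X⟧) m
  rw [qInt] at h
  rw [h, mul_zero, eq_comm, sub_eq_zero] at h1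
  have h2 : (Polynomial.X + Polynomial.C u) ^ m = (1 : Polynomial k) := by
    apply Polynomial.coe_injective (R := k)
    simpa [add_comm] using h1
  have h3 := congrArg Polynomial.natDegree h2
  simp [hm] at h3

open PowerSeries in
/-- The Poincaré–Birkhoff–Witt theorem for quantized Weyl algebras. -/
theorem linearIndependent_gen (hq : ∀ i, q i i = 1) (hqq : ∀ i j, q i j * q j i = 1) :
    LinearIndependent k (orderedMonomial (generators n) (gen q γ)) := by
  -- Power series are used rather than polynomials so that `γ i + X` is a unit. The ring is still a
  -- domain, and the constant coefficient recovers `γ i`.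
  let : Algebra k⟦X⟧ k := (constantCoeff (R := k)).toAlgebra
  have hunit (i : Fin n) : IsUnit (PowerSeries.C (γ i : k) + X : k⟦X⟧) := by
    rw [PowerSeries.isUnit_iff_constantCoeff]
    simp
  let γ' (i : Fin n) : k⟦X⟧ˣ := (hunit i).unit
  let q' (i j : Fin n) : k⟦X⟧ˣ := Units.map (PowerSeries.C : k →+* k⟦X⟧) (q i j)
  have h := linearIndependent_gen_of_qInt_ne_zero (q := q') (γ := γ') (by simp [q', hq])
    (fun i j => by simp only [q', ← map_mul, hqq, map_one])
    (fun i m hm => qInt_C_add_X_ne_zero (γ i : k) hm)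
  have h' := linearIndependent_gen_map (K := k) (by simp [q', hq])
    (fun i j => by simp only [q', ← map_mul, hqq, map_one]) h
  have hq' : (fun i j => Units.map (algebraMap k⟦X⟧ k : k⟦X⟧ →* k) (q' i j)) = q := by
    funext i j
    ext
    simp [q', RingHom.algebraMap_toAlgebra]
  have hγ' : (fun i => Units.map (algebraMap k⟦X⟧ k : k⟦X⟧ →* k) (γ' i)) = γ := by
    funext i
    ext
    simp [γ', RingHom.algebraMap_toAlgebra]
  rwa [hq', hγ'] at h'

end Field

end QuantizedWeyl

/-! ### Associated graded rings that are quantum affine spaces -/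

section GradedQuantum

variable {ι T S : Type*} [CommRing T] [Ring S] [Algebra T S]

theorem adjoin_eq_top_of_span_orderedMonomial {g : ι → S} {L : List ι}
    (hspan : Submodule.span T (Set.range (orderedMonomial L g)) = ⊤) :
    Algebra.adjoin T (Set.range g) = ⊤ := by
  rw [← Algebra.toSubmodule_eq_top, eq_top_iff, ← hspan, Submodule.span_le]
  rintro _ ⟨a, rfl⟩
  refine Subalgebra.list_prod_mem _ fun x hx => ?_
  obtain ⟨c, -, rfl⟩ := List.mem_map.1 hx
  exact pow_mem (Algebra.subset_adjoin (Set.mem_range_self c)) _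

namespace AlgFiltration

variable (F : AlgFiltration T S) {g : ι → S} {d : ι → ℕ} (hg : ∀ c, g c ∈ F.obj (d c))

/-- The classes of generators in the associated graded ring. -/
def gradedGen (c : ι) : F.Gr := F.symbol (d c) (g c) (hg c)

theorem gradedGen_mul {p : ι → ι → Tˣ}
    (hcomm : ∀ c c', g c * g c' - (p c c' : T) • (g c' * g c) ∈ F.below (d c + d c')) (c c' : ι) :
    F.gradedGen hg c * F.gradedGen hg c' =
      (p c c' : T) • (F.gradedGen hg c' * F.gradedGen hg c) := by
  have hmem : g c' * g c ∈ F.obj (d c + d c') := add_comm (d c) (d c') ▸ F.mul_mem (hg c') (hg c)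
  rw [gradedGen, gradedGen, symbol_mul, symbol_mul,
    F.symbol_congr (F.mul_mem (hg c') (hg c)) hmem (add_comm _ _) rfl, ← F.symbol_smul]
  exact F.symbol_eq_symbol (hcomm c c')

variable {L : List ι}
  (hobj : ∀ m, F.obj m = Submodule.span T (orderedMonomial L g '' {a | wordDegree L d a ≤ m}))
include hobj

theorem orderedMonomial_gradedGen :
    orderedMonomial L (F.gradedGen hg) = fun a => F.symbol (wordDegree L d a)
      (orderedMonomial L g a) (F.mem_obj_of_obj_eq_span hobj a) :=
  funext fun a => F.orderedMonomial_symbol hg L a _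

theorem span_orderedMonomial_gradedGen :
    Submodule.span T (Set.range (orderedMonomial L (F.gradedGen hg))) = ⊤ := by
  rw [F.orderedMonomial_gradedGen hg hobj]
  exact F.span_symbol_eq_top hobj

theorem linearIndependent_orderedMonomial_gradedGen
    (hli : LinearIndependent T (orderedMonomial L g)) :
    LinearIndependent T (orderedMonomial L (F.gradedGen hg)) := by
  rw [F.orderedMonomial_gradedGen hg hobj]
  exact F.linearIndependent_symbol hli hobj

/-- The basis of the associated graded ring given by the ordered monomials. -/
noncomputable def gradedBasis (hli : LinearIndependent T (orderedMonomial L g)) :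
    Module.Basis (ι →₀ ℕ) T F.Gr :=
  .mk (F.linearIndependent_orderedMonomial_gradedGen hg hobj hli)
    (F.span_orderedMonomial_gradedGen hg hobj).ge

theorem gradedBasis_apply (hli : LinearIndependent T (orderedMonomial L g)) (a : ι →₀ ℕ) :
    F.gradedBasis hg hobj hli a = orderedMonomial L (F.gradedGen hg) a := by
  simp [gradedBasis]

theorem exists_quantumAffineSpace_equiv [DecidableEq ι] (hL : ∀ c, L.count c = 1)
    (hli : LinearIndependent T (orderedMonomial L g)) {p : ι → ι → Tˣ}
    (hcomm : ∀ c c', g c * g c' - (p c c' : T) • (g c' * g c) ∈ F.below (d c + d c')) :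
    ∃ e : QuantumAffineSpace p ≃ₐ[T] F.Gr,
      ∀ c, e (QuantumAffineSpace.z p c) = F.symbol (d c) (g c) (hg c) :=
  ⟨AlgEquiv.ofBijective _ (QuantumAffineSpace.lift_bijective p _ (F.gradedGen_mul hg hcomm) hL
    (F.linearIndependent_orderedMonomial_gradedGen hg hobj hli)
    (F.span_orderedMonomial_gradedGen hg hobj)), fun c => by
      simp [gradedGen]⟩

include hg in
-- After base change to `C`, the ordered monomials still span and still multiply up to units, so the
-- leading monomial argument applies over `C`.
theorem isStronglyNoetherian_gr [Finite ι] [DecidableEq ι] (hL : ∀ c, L.count c = 1)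
    (hli : LinearIndependent T (orderedMonomial L g)) {p : ι → ι → Tˣ}
    (hcomm : ∀ c c', g c * g c' - (p c c' : T) • (g c' * g c) ∈ F.below (d c + d c')) :
    IsStronglyNoetherian.{w} T F.Gr := by
  intro C _ _ hC
  let g' (c : ι) : C ⊗[T] F.Gr := 1 ⊗ₜ F.gradedGen hg c
  have hmul (c c' : ι) : ∃ u : Cˣ, g' c * g' c' = (u : C) • (g' c' * g' c) := by
    refine ⟨Units.map (algebraMap T C : T →* C) (p c c'), ?_⟩
    simp only [g', Algebra.TensorProduct.tmul_mul_tmul, F.gradedGen_mul hg hcomm c c', mul_one]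
    rw [TensorProduct.tmul_smul, Units.coe_map, MonoidHom.coe_coe, algebraMap_smul]
  refine isTwoSidedNoetherian_of_monomial_mul (C := C) (e := orderedMonomial L g')
    (exists_orderedMonomial_mul hmul hL) ?_
  rw [← ((F.gradedBasis hg hobj hli).baseChange C).span_eq]
  congr 2
  funext a
  rw [Module.Basis.baseChange_apply, gradedBasis_apply]
  exact (map_orderedMonomial (Algebra.TensorProduct.includeRight : F.Gr →ₐ[T] C ⊗[T] F.Gr)
    _ _ _).symm

end AlgFiltration

end GradedQuantum

theorem AlgFiltration.isOrder_grIncl {ι D K A : Type*} [CommRing D] [CommRing K] [Ring A] [Algebra D K]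
    [Algebra K A] [Algebra D A] [IsScalarTower D K A] (hDK : Function.Injective (algebraMap D K))
    (F : AlgFiltration K A) (B : Subalgebra D A) {g : ι → B} {d : ι → ℕ}
    (hg : ∀ c, (g c : A) ∈ F.obj (d c)) {L : List ι}
    (hobj : ∀ m, F.obj m =
      Submodule.span K (orderedMonomial L (fun c => (g c : A)) '' {a | wordDegree L d a ≤ m}))
    (hobjB : ∀ m, (F.induced B).obj m =
      Submodule.span D (orderedMonomial L g '' {a | wordDegree L d a ≤ m}))
    (hli : LinearIndependent K (orderedMonomial L fun c => (g c : A)))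
    (hliB : LinearIndependent D (orderedMonomial L g)) : IsOrder K (F.grIncl B) := by
  have hgB (c : ι) : g c ∈ (F.induced B).obj (d c) := hg c
  refine IsOrder.of_basis hDK ((F.induced B).gradedBasis hgB hobjB hliB)
    (F.gradedBasis hg hobj hli) (F.grIncl B) fun a => ?_
  rw [gradedBasis_apply, gradedBasis_apply, map_orderedMonomial]
  congr 1
  funext c
  exact F.grIncl_symbol B (hgB c)

namespace QuantizedWeyl

/-! ### Reductions to finite fields -/

theorem exists_pow_eq_one_and_sum_eq_zero (K : Type*) [CommRing K] [IsDomain K] [Finite K] :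
    ∃ N : ℕ, 0 < N ∧ ∀ u : Kˣ, u ^ N = 1 ∧ ∑ i ∈ Finset.range N, (u : K) ^ i = 0 := by
  have := Fintype.ofFinite K
  -- The factor `|Kˣ|` gives `u ^ N = 1`, which makes the geometric sum vanish for `u ≠ 1`. For `u =
  -- 1` the sum is `N`, which is zero in `K` owing to the factor `|K|`.
  refine ⟨Nat.card K * Nat.card Kˣ, Nat.mul_pos Nat.card_pos Nat.card_pos, fun u => ?_⟩
  have hu : u ^ (Nat.card K * Nat.card Kˣ) = 1 := by
    rw [mul_comm, pow_mul, pow_card_eq_one', one_pow]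
  refine ⟨hu, ?_⟩
  rcases eq_or_ne (u : K) 1 with h1 | h1
  · simp [h1]
  · have h2 := mul_geom_sum (u : K) (Nat.card K * Nat.card Kˣ)
    rw [← Units.val_pow_eq_pow_val, hu, Units.val_one, sub_self] at h2
    exact (mul_eq_zero.1 h2).resolve_left (sub_ne_zero.2 h1)

theorem Satisfies.isTwoSidedNoetherian_and_isPIAlgebra {K S : Type*} [CommRing K] [IsDomain K]
    [Finite K] [Ring S] [Algebra K S] {n : ℕ} {q : Fin n → Fin n → Kˣ} {γ : Fin n → Kˣ}
    {g : Fin n ⊕ Fin n → S} (h : Satisfies q γ g) (hqq : ∀ i j, q i j * q j i = 1)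
    {L : List (Fin n ⊕ Fin n)}
    (hspan : Submodule.span K (Set.range (orderedMonomial L g)) = ⊤) :
    IsTwoSidedNoetherian S ∧ IsPIAlgebra K S := by
  obtain ⟨N, hN, hu⟩ := exists_pow_eq_one_and_sum_eq_zero K
  refine isTwoSidedNoetherian_and_isPIAlgebra_of_central_pow hN (fun c => ?_) hspan
  rw [Subalgebra.mem_center_iff]
  intro s
  have hs : s ∈ Algebra.adjoin K (Set.range g) := by
    rw [adjoin_eq_top_of_span_orderedMonomial hspan]
    trivial
  have hle : Algebra.adjoin K (Set.range g) ≤ Subalgebra.centralizer K {g c ^ N} := by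
    refine Algebra.adjoin_le ?_
    rintro _ ⟨c', rfl⟩
    rw [SetLike.mem_coe, Subalgebra.mem_centralizer_iff]
    rintro _ rfl
    exact (h.commute_pow hqq hu c' c).eq.symm
  exact ((Subalgebra.mem_centralizer_iff K).1 (hle hs) _ rfl).symm

theorem Satisfies.reduction {D B : Type*} [CommRing D] [Ring B] [Algebra D B] {n : ℕ}
    {q : Fin n → Fin n → Dˣ} {γ : Fin n → Dˣ} {g : Fin n ⊕ Fin n → B} (h : Satisfies q γ g)
    (hqq : ∀ i j, q i j * q j i = 1) {L : List (Fin n ⊕ Fin n)}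
    (hli : LinearIndependent D (orderedMonomial L g))
    (hspan : Submodule.span D (Set.range (orderedMonomial L g)) = ⊤)
    (K : Type*) [CommRing K] [IsDomain K] [Finite K] [Algebra D K] :
    Algebra.FiniteType K (K ⊗[D] B) ∧ IsTwoSidedNoetherian (K ⊗[D] B) ∧
      IsPIAlgebra K (K ⊗[D] B) := by
  let b : Module.Basis _ D B := .mk hli hspan.ge
  have hspan' : Submodule.span K (Set.range (orderedMonomial L
      fun c => (1 : K) ⊗ₜ[D] g c)) = ⊤ := by
    rw [← (b.baseChange K).span_eq]
    congr 2
    funext a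
    rw [Module.Basis.baseChange_apply, Module.Basis.mk_apply]
    exact (map_orderedMonomial (Algebra.TensorProduct.includeRight : B →ₐ[D] K ⊗[D] B) _ _ _).symm
  refine ⟨⟨Subalgebra.fg_def.2 ⟨_, Set.finite_range _,
    adjoin_eq_top_of_span_orderedMonomial hspan'⟩⟩, ?_⟩
  refine (h.baseChange K).isTwoSidedNoetherian_and_isPIAlgebra (fun i j => ?_) hspan'
  rw [← map_mul, hqq, map_one]

/-! ### Integral forms -/

section IntegralForm

variable {k A : Type*} [Field k] [Ring A] [Algebra k A] {n : ℕ}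

/-- The subalgebra `B` over the subring `D` of `k` is generated by elements `g` that satisfy the
relations of a quantized Weyl algebra over `D`, and whose ordered monomials form a basis over `k`
of the ambient algebra that is compatible with the filtration `F`. -/
structure IsIntegralForm (F : AlgFiltration k A) {D : Subalgebra ℤ k} (B : Subalgebra D A)
    (q : Fin n → Fin n → Dˣ) (γ : Fin n → Dˣ) (g : Fin n ⊕ Fin n → B) : Prop where
  satisfies : Satisfies q γ g
  q_self (i : Fin n) : q i i = 1
  q_mul (i j : Fin n) : q i j * q j i = 1
  adjoin_eq_top : Algebra.adjoin D (Set.range g) = ⊤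
  mem_obj (c : Fin n ⊕ Fin n) : (g c : A) ∈ F.obj (deg c)
  obj_eq_span (m : ℕ) : F.obj m = Submodule.span k
    (orderedMonomial (generators n) (fun c => (g c : A)) ''
      {a | wordDegree (generators n) deg a ≤ m})
  linearIndependent :
    LinearIndependent k (orderedMonomial (generators n) fun c => (g c : A))

namespace IsIntegralForm

variable {F : AlgFiltration k A} {D : Subalgebra ℤ k} {B : Subalgebra D A}
  {q : Fin n → Fin n → Dˣ} {γ : Fin n → Dˣ} {g : Fin n ⊕ Fin n → B}
  (h : IsIntegralForm F B q γ g)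
include h

/-- The basis of the ambient algebra that consists of the ordered monomials. -/
noncomputable def basis : Module.Basis (Fin n ⊕ Fin n →₀ ℕ) k A :=
  .mk h.linearIndependent (F.span_range_eq_top h.obj_eq_span).ge

theorem basis_apply (a : Fin n ⊕ Fin n →₀ ℕ) :
    h.basis a = orderedMonomial (generators n) (fun c => (g c : A)) a := by
  simp [basis]

theorem linearIndependent_integral :
    LinearIndependent D (orderedMonomial (generators n) g) := by
  refine LinearIndependent.of_comp B.val.toLinearMap ?_
  have heq : B.val.toLinearMap ∘ orderedMonomial (generators n) g =
      orderedMonomial (generators n) fun c => (g c : A) :=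
    funext fun a => map_orderedMonomial B.val _ _ _
  rw [heq]
  refine h.linearIndependent.restrict_scalars fun x y hxy => ?_
  simpa [Algebra.smul_def] using hxy

/-- Sorting takes place over `D`, because all commutation parameters are units of `D`. It is applied
to the degree filtration intrinsic to `B`; the induced filtration is identified with it only
afterwards, by `induced_obj_eq_span`. -/
theorem ofDegrees_obj_eq_span (m : ℕ) :
    (AlgFiltration.ofDegrees g deg h.adjoin_eq_top).obj m =
      Submodule.span D (orderedMonomial (generators n) g ''
        {a | wordDegree (generators n) deg a ≤ m}) :=
  AlgFiltration.ofDegrees_obj_eq_span h.adjoin_eq_top (fun c c' => ⟨_,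
    h.satisfies.sub_mem_below h.q_self h.q_mul _
      (AlgFiltration.gen_mem_ofDegrees _ _ _) c c'⟩) count_generators m

theorem span_range_integral :
    Submodule.span D (Set.range (orderedMonomial (generators n) g)) = ⊤ :=
  AlgFiltration.span_range_eq_top _ h.ofDegrees_obj_eq_span

/-- The basis of the integral form that consists of the ordered monomials. -/
noncomputable def integralBasis : Module.Basis (Fin n ⊕ Fin n →₀ ℕ) D B :=
  .mk h.linearIndependent_integral
    h.span_range_integral.ge

theorem integralBasis_apply (a : Fin n ⊕ Fin n →₀ ℕ) :
    h.integralBasis a = orderedMonomial (generators n) g a := by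
  simp [integralBasis]

theorem coe_integralBasis (a : Fin n ⊕ Fin n →₀ ℕ) : (h.integralBasis a : A) = h.basis a := by
  rw [integralBasis_apply, basis_apply]
  exact map_orderedMonomial B.val _ _ _

omit h in
theorem algebraMap_injective (D : Subalgebra ℤ k) : Function.Injective (algebraMap D k) :=
  Subtype.val_injective

theorem induced_obj_eq_span (m : ℕ) :
    (F.induced B).obj m = Submodule.span D (orderedMonomial (generators n) g ''
      {a | wordDegree (generators n) deg a ≤ m}) := by
  have := F.induced_obj_eq_span B (algebraMap_injective D) h.integralBasis h.basis
    h.coe_integralBasis (δ := wordDegree (generators n) deg)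
    (by simpa [basis] using h.obj_eq_span) m
  simpa [integralBasis] using this

theorem sub_mem_induced_below (c c' : Fin n ⊕ Fin n) :
    g c * g c' - (commParam q γ c c' : D) • (g c' * g c) ∈
      (F.induced B).below (deg c + deg c') :=
  h.satisfies.sub_mem_below h.q_self h.q_mul (F.induced B) h.mem_obj c c'

/-- The induced filtration coincides with the degree filtration of `B`, whose terms are spanned by
finitely many words. -/
theorem isLocallyFinite_induced : (F.induced B).IsLocallyFinite := by
  intro m
  rw [h.induced_obj_eq_span, ← h.ofDegrees_obj_eq_span]
  exact AlgFiltration.ofDegrees_isLocallyFinite h.adjoin_eq_top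
    (fun c => by rw [deg_eq]; omega) m

theorem isCongenialVia (hF : F.IsLocallyFinite) (hD : D.FG) : IsCongenialVia.{w} F D B where
  locallyFinite := hF
  affine := hD
  order := IsOrder.of_basis (algebraMap_injective D) h.integralBasis h.basis _ h.coe_integralBasis
  order_locallyFinite := h.isLocallyFinite_induced
  gr_order := AlgFiltration.isOrder_grIncl (algebraMap_injective D) F B h.mem_obj h.obj_eq_span
    h.induced_obj_eq_span h.linearIndependent h.linearIndependent_integral
  gr_stronglyNoetherian := (F.induced B).isStronglyNoetherian_gr h.mem_obj h.induced_obj_eq_span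
    count_generators h.linearIndependent_integral h.sub_mem_induced_below
  gr_locallyFinite := (F.induced B).isLocallyFinite_piece h.isLocallyFinite_induced
  reduction P _ _ :=
    h.satisfies.reduction h.q_mul h.linearIndependent_integral h.span_range_integral (D ⧸ P)

theorem exists_quantumAffineSpace_equiv_induced :
    ∃ e : QuantumAffineSpace (commParam q γ) ≃ₐ[D] (F.induced B).Gr,
      ∀ c, e (QuantumAffineSpace.z _ c) = (F.induced B).symbol (deg c) (g c) (h.mem_obj c) :=
  (F.induced B).exists_quantumAffineSpace_equiv h.mem_obj h.induced_obj_eq_span count_generators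
    h.linearIndependent_integral h.sub_mem_induced_below

theorem exists_quantumAffineSpace_equiv :
    ∃ e : QuantumAffineSpace (fun c c' =>
        Units.map (algebraMap D k : D →* k) (commParam q γ c c')) ≃ₐ[k] F.Gr,
      ∀ c, e (QuantumAffineSpace.z _ c) = F.symbol (deg c) (g c : A) (h.mem_obj c) :=
  F.exists_quantumAffineSpace_equiv h.mem_obj h.obj_eq_span count_generators h.linearIndependent
    fun c c' => F.induced_below B (h.sub_mem_induced_below c c')

end IsIntegralForm

end IntegralForm

/-! ### The coefficient ring and the integral form of the quantized Weyl algebra -/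

section CoeffRing

variable {k : Type*} [Field k] {n : ℕ} (q : Fin n → Fin n → kˣ) (γ : Fin n → kˣ)

theorem fg_coeffRing : (coeffRing q γ).FG :=
  Subalgebra.fg_def.2 ⟨_, ((Set.finite_range _).union (Set.finite_range _)).union
    (Set.finite_range _), rfl⟩

theorem q_mem_coeffRing (i j : Fin n) : (q i j : k) ∈ coeffRing q γ :=
  Algebra.subset_adjoin (.inl (.inl ⟨(i, j), rfl⟩))

/-- The parameters `q_ij` as units of the coefficient ring. -/
def integralQ (hqq : ∀ i j, q i j * q j i = 1) (i j : Fin n) : (coeffRing q γ)ˣ where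
  val := ⟨q i j, q_mem_coeffRing q γ i j⟩
  inv := ⟨q j i, q_mem_coeffRing q γ j i⟩
  val_inv := Subtype.ext (by simpa using congrArg Units.val (hqq i j))
  inv_val := Subtype.ext (by simpa using congrArg Units.val (hqq j i))

/-- The parameters `γ_i` as units of the coefficient ring. -/
def integralGamma (i : Fin n) : (coeffRing q γ)ˣ where
  val := ⟨γ i, Algebra.subset_adjoin (.inl (.inr ⟨i, rfl⟩))⟩
  inv := ⟨(γ i : k)⁻¹, Algebra.subset_adjoin (.inr ⟨i, rfl⟩)⟩
  val_inv := Subtype.ext (by simp)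
  inv_val := Subtype.ext (by simp)

variable {q γ}

theorem satisfies_integralGen (hqq : ∀ i j, q i j * q j i = 1) :
    Satisfies (integralQ q γ hqq) (integralGamma q γ) (integralGen q γ) where
  yy i j := Subtype.ext ((satisfies_gen q γ).yy i j)
  xx i j h := Subtype.ext ((satisfies_gen q γ).xx i j h)
  xy_lt i j h := Subtype.ext ((satisfies_gen q γ).xy_lt i j h)
  xy_gt i j h := Subtype.ext ((satisfies_gen q γ).xy_gt i j h)
  xy_eq j := Subtype.ext (by
    refine ((satisfies_gen q γ).xy_eq j).trans ?_
    push_cast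
    rfl)

theorem adjoin_integralGen :
    Algebra.adjoin (coeffRing q γ) (Set.range (integralGen q γ)) = ⊤ := by
  have h : Set.range (integralGen q γ) = ((↑) : integralForm q γ → QuantizedWeyl q γ) ⁻¹'
      Set.range (gen q γ) := by
    ext s
    simp [integralGen, Subtype.ext_iff]
  rw [h]
  exact Algebra.adjoin_adjoin_coe_preimage

theorem isIntegralForm_integralForm (hq : ∀ i, q i i = 1) (hqq : ∀ i j, q i j * q j i = 1) :
    IsIntegralForm (filtration q γ) (integralForm q γ) (integralQ q γ hqq) (integralGamma q γ)
      (integralGen q γ) where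
  satisfies := satisfies_integralGen hqq
  q_self i := Units.ext (Subtype.ext (by simp [integralQ, hq]))
  q_mul i j := Units.ext (integralQ q γ hqq i j).val_inv
  adjoin_eq_top := adjoin_integralGen
  mem_obj := integralGen_mem q γ
  obj_eq_span := filtration_obj_eq_span hq hqq
  linearIndependent := linearIndependent_gen hq hqq

end CoeffRing

end QuantizedWeyl

/-! ### The main theorem -/

theorem mainTheorem6 {k : Type*} [Field k] (n : ℕ)
    (q : Fin n → Fin n → kˣ) (γ : Fin n → kˣ)
    (hq_diag : ∀ i, q i i = 1) (hq : ∀ i j, i ≠ j → q i j * q j i = 1) :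
    -- The filtered algebra is congenial,
    IsCongenial.{w} (QuantizedWeyl.filtration q γ) ∧
    -- by means of its integral form; in particular the reductions of the latter are PI.
    IsCongenialVia.{w} (QuantizedWeyl.filtration q γ) (QuantizedWeyl.coeffRing q γ)
      (QuantizedWeyl.integralForm q γ) ∧
    -- The associated graded rings of the algebra and of its integral form are quantum affine
    -- spaces on the symbols of the generators, with the same parameters.
    ∃ p : (Fin n ⊕ Fin n) → (Fin n ⊕ Fin n) → (QuantizedWeyl.coeffRing q γ)ˣ,
      IsMultiplicativelyAntisymmetric p ∧
      (∃ e : QuantumAffineSpace p ≃ₐ[QuantizedWeyl.coeffRing q γ]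
            ((QuantizedWeyl.filtration q γ).induced (QuantizedWeyl.integralForm q γ)).Gr,
        ∀ c, e (QuantumAffineSpace.z p c) =
          ((QuantizedWeyl.filtration q γ).induced (QuantizedWeyl.integralForm q γ)).symbol
            (QuantizedWeyl.deg c) (QuantizedWeyl.integralGen q γ c)
            (QuantizedWeyl.integralGen_mem q γ c)) ∧
      (∃ e : QuantumAffineSpace (fun c d =>
            Units.map (algebraMap (QuantizedWeyl.coeffRing q γ) k : _ →* k) (p c d)) ≃ₐ[k]
            (QuantizedWeyl.filtration q γ).Gr,
        ∀ c, e (QuantumAffineSpace.z _ c) =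
          (QuantizedWeyl.filtration q γ).symbol (QuantizedWeyl.deg c) (QuantizedWeyl.gen q γ c)
            (QuantizedWeyl.gen_mem q γ c)) := by
  have hqq : ∀ i j, q i j * q j i = 1 := by
    intro i j
    rcases eq_or_ne i j with rfl | h
    · rw [hq_diag, one_mul]
    · exact hq i j h
  have hform := QuantizedWeyl.isIntegralForm_integralForm (γ := γ) hq_diag hqq
  have hfin : (QuantizedWeyl.filtration q γ).IsLocallyFinite :=
    AlgFiltration.ofDegrees_isLocallyFinite (QuantizedWeyl.adjoin_gen q γ) fun c => by
      rw [QuantizedWeyl.deg_eq]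
      omega
  have hvia : IsCongenialVia.{w} (QuantizedWeyl.filtration q γ) (QuantizedWeyl.coeffRing q γ)
      (QuantizedWeyl.integralForm q γ) :=
    hform.isCongenialVia hfin (QuantizedWeyl.fg_coeffRing q γ)
  exact ⟨⟨_, _, hvia⟩, hvia, _,
    QuantizedWeyl.isMultiplicativelyAntisymmetric_commParam hform.q_self hform.q_mul,
    hform.exists_quantumAffineSpace_equiv_induced, hform.exists_quantumAffineSpace_equiv⟩
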